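/- Let \(n\in\mathbb N\) and \(1<p<n\). A bounded domain is a nonempty, bounded, connected open set \(\Omega\subset\mathbb R^n\), and \(W^{1,p}_0(\Omega)\) is the closure of \(C_c^\infty(\Omega)\) in \(W^{1,p}(\Omega)\). For \(f\in L^q(\Omega)\), \(q>1\), a weak solution of \[ -\operatorname{div}(|\nabla u|^{p-2}\nabla u)=f \text{ in }\Omega,\qquad u=0\text{ on }\partial\Omega \qquad(\ast)\] is a function \(u\in W_0^{1,p}(\Omega)\) with \(\int_\Omega|\nabla u|^{p-2}\nabla u\cdot\nabla\varphi\,dx=\int_\Omega f\varphi\,dx\) for every \(\varphi\in C_c^\infty(\Omega)\). (i) Let \(1<q<\frac np\) and \(0<r<\frac{(p-1)qn}{n-pq}\). For every \(M\ge 0\) there is a constant \(C\), depending only on \(n,p,q,r,M\), such that for every bounded domain \(\Omega\) of Lebesgue measure \(|\Omega|\le M\), every \(f\in L^q(\Omega)\) and every weak solution \(u\) of \((\ast)\), one has \(u\in L^r(\Omega)\) and \[ \|u\|_{r}\le C\|f\|_{q}^{\frac1{p-1}}. \] (ii) The exponent is sharp: if \(\frac{np}{np-n+p}\le q<\frac np\)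 and \(r>\frac{(p-1)qn}{n-pq}\), then for every bounded domain \(\Omega\) (in particular for the unit ball) there are \(f\in L^q(\Omega)\) and a weak solution \(u\) of \((\ast)\) such that \(u\notin L^r(\Omega)\). (iii) If \(q=\frac np\), then the conclusion of (i) holds for every \(0<r<\infty\). (For \(0<r<1\), \(\|u\|_r\) denotes \((\int_\Omega|u|^r\,dx)^{1/r}\).) -/

import Mathlib

open MeasureTheory Filter Topology
open scoped ENNReal NNReal ContDiff

/-- A bounded domain: a nonempty, connected, bounded open subset of `ℝⁿ`. -/
structure IsBoundedDomain {n : ℕ} (Ω : Set (EuclideanSpace ℝ (Fin n))) : Prop where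
  isOpen : IsOpen Ω
  isConnected : IsConnected Ω
  isBounded : Bornology.IsBounded Ω

/-- `φ ∈ C_c^∞(Ω)`: smooth functions with compact support contained in `Ω`. -/
structure IsTestFunction {n : ℕ} (Ω : Set (EuclideanSpace ℝ (Fin n)))
    (φ : EuclideanSpace ℝ (Fin n) → ℝ) : Prop where
  contDiff : ContDiff ℝ ∞ φ
  hasCompactSupport : HasCompactSupport φ
  tsupport_subset : tsupport φ ⊆ Ω

/-- `u ∈ W^{1,p}(Ω)` with weak gradient `G`: both `u` and `G` are in `L^p(Ω)`, and
`∫_Ω u ∂_v φ = - ∫_Ω φ ⟨G, v⟩` for all test functions `φ` and all directions `v`. -/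
structure IsW1pWithGrad {n : ℕ} (p : ℝ) (Ω : Set (EuclideanSpace ℝ (Fin n)))
    (u : EuclideanSpace ℝ (Fin n) → ℝ)
    (G : EuclideanSpace ℝ (Fin n) → EuclideanSpace ℝ (Fin n)) : Prop where
  memLp : MemLp u (ENNReal.ofReal p) (volume.restrict Ω)
  memLp_grad : MemLp G (ENNReal.ofReal p) (volume.restrict Ω)
  integral_by_parts : ∀ φ : EuclideanSpace ℝ (Fin n) → ℝ, IsTestFunction Ω φ →
    ∀ v : EuclideanSpace ℝ (Fin n),
      ∫ x in Ω, u x * fderiv ℝ φ x v = - ∫ x in Ω, φ x * inner ℝ (G x) v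

/-- `u ∈ W_0^{1,p}(Ω)` with weak gradient `G`: `u ∈ W^{1,p}(Ω)` has weak gradient `G` and is a
limit, in the norm of `W^{1,p}(Ω)`, of a sequence of functions of `C_c^∞(Ω)`. -/
structure IsW1pZeroWithGrad {n : ℕ} (p : ℝ) (Ω : Set (EuclideanSpace ℝ (Fin n)))
    (u : EuclideanSpace ℝ (Fin n) → ℝ)
    (G : EuclideanSpace ℝ (Fin n) → EuclideanSpace ℝ (Fin n)) : Prop where
  isW1p : IsW1pWithGrad p Ω u G
  exists_approx : ∃ φ : ℕ → EuclideanSpace ℝ (Fin n) → ℝ,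
    (∀ k, IsTestFunction Ω (φ k)) ∧
    Tendsto (fun k => eLpNorm (fun x => u x - φ k x) (ENNReal.ofReal p) (volume.restrict Ω))
      atTop (𝓝 0) ∧
    Tendsto
      (fun k => eLpNorm (fun x => G x - gradient (φ k) x) (ENNReal.ofReal p) (volume.restrict Ω))
      atTop (𝓝 0)

/-- `u` is a weak solution of the Dirichlet problem `-div(|∇u|^{p-2} ∇u) = f` in `Ω`, `u = 0` on
`∂Ω`: `u ∈ W_0^{1,p}(Ω)` and its weak gradient `G` (unique up to null sets) satisfies
`∫_Ω |G|^{p-2} ⟨G, ∇φ⟩ = ∫_Ω f φ` for all `φ ∈ C_c^∞(Ω)`. -/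
def IsWeakSolution {n : ℕ} (p : ℝ) (Ω : Set (EuclideanSpace ℝ (Fin n)))
    (f u : EuclideanSpace ℝ (Fin n) → ℝ) : Prop :=
  ∃ G : EuclideanSpace ℝ (Fin n) → EuclideanSpace ℝ (Fin n),
    IsW1pZeroWithGrad p Ω u G ∧
    ∀ φ : EuclideanSpace ℝ (Fin n) → ℝ, IsTestFunction Ω φ →
      ∫ x in Ω, ‖G x‖ ^ (p - 2) * inner ℝ (G x) (gradient φ x) = ∫ x in Ω, f x * φ x

/-- The a priori estimate `‖u‖_r ≤ C ‖f‖_q^{1/(p-1)}` (including `u ∈ L^r(Ω)`), for all bounded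
domains `Ω ⊆ ℝⁿ`, all `f ∈ L^q(Ω)` and all weak solutions `u` with datum `f`; the constant `C`
depends only on `n`, `p`, `q`, `r` and an upper bound `M` for the measure of `Ω`. -/
def LebesgueEstimate (n : ℕ) (p q r : ℝ) : Prop :=
  ∀ M : ℝ≥0, ∃ C : ℝ≥0, ∀ Ω : Set (EuclideanSpace ℝ (Fin n)), IsBoundedDomain Ω →
    volume Ω ≤ (M : ℝ≥0∞) →
    ∀ f u : EuclideanSpace ℝ (Fin n) → ℝ,
      MemLp f (ENNReal.ofReal q) (volume.restrict Ω) → IsWeakSolution p Ω f u →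
      MemLp u (ENNReal.ofReal r) (volume.restrict Ω) ∧
      eLpNorm u (ENNReal.ofReal r) (volume.restrict Ω) ≤
        (C : ℝ≥0∞) * eLpNorm f (ENNReal.ofReal q) (volume.restrict Ω) ^ (1 / (p - 1))

/-!
The estimates come from testing the equation with powers of `u`. If `F` is smooth and bounded with
bounded derivative and `F(0) = 0`, then `F(u)` is admissible as a test function and
`∫ F'(u) |∇u|^p = ∫ f F(u)` (`IsW1pZeroWithGrad.integral_deriv_mul_norm_rpow`); this needs only
`f ∈ L^1`, so it also covers exponents `q` for which `f` is not in the dual of `W_0^{1,p}`. If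
moreover `|Φ'|^p ≤ K F'`, the Sobolev inequality for `Φ(u)` gives
`‖Φ(u)‖_{p*}^p ≤ C ‖f‖_q ‖F(u)‖_{q'}` (`exists_eLpNorm_comp_rpow_le`). Take `F` and `Φ` to be smooth
powers, of degrees `pδ + 1` and `δ + 1`, of a truncation of `u`, with `δ` chosen such that
`(δ + 1) p* = (pδ + 1) q'`. This common value is the critical exponent `s = (p-1)qn/(n-pq)`. For
`‖f‖_q ≤ 1`, both sides are then controlled by the same integral `W`, of the power `s` of the
truncation, and `W ≤ D (1 + W^θ)`, where `θ < 1` because `pq < n`. Hence `W` is bounded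
independently of the truncation height, and Fatou's lemma gives the bound for `u`, including the
case `r = s` (`lebesgueEstimate_of_le`). General data are reduced to `‖f‖_q ≤ 1` by the
homogeneity of the equation (`eLpNorm_le_of_unit_data`), and `q = n/p` to exponents slightly below
`n/p` by Hölder's inequality.

For the sharpness, let `x₀ ∈ Ω` and `α = n/r`. The solution is a radial function around `x₀` with
compact support in `Ω` which behaves like `|x - x₀|^{-α}` near `x₀`, so it is not in `L^r`. Its
profile is chosen through its derivative: with the cutoff `e^{-1/(R²-t)}`, `t = |x - x₀|²`, all
positive powers of the cutoff are again smooth, so the flux `|∇u|^{p-2} ∇u` is smooth away from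
`x₀` for every `p > 1` (`norm_rpow_mul_inner_cutPow`), and `f`, minus its divergence, is explicit
and of order `|x - x₀|^{-μ}` with `μ = (α + 1)(p - 1) + 1`. The hypothesis `r > s` is equivalent to `μ q < n`,
which gives `f ∈ L^q`, and together with the lower bound on `q` it implies `(α + 1) p < n`, which
gives `∇u ∈ L^p`. Replacing `|x - x₀|²` by `|x - x₀|² + e` with `e ↓ 0` produces smooth
approximations dominated by the same power functions, so both `u ∈ W_0^{1,p}`
(`isW1pZeroWithGrad_cutPrimitive`) and the weak equation (`integral_cutPow_mul_inner_gradient`)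
follow by dominated convergence.
-/

/-! ### Convergence in Lebesgue spaces -/

/-- Dominated convergence in `L^p`, for sequences tending to zero. -/
theorem tendsto_eLpNorm_zero_of_dominated {α E : Type*} [MeasurableSpace α]
    [NormedAddCommGroup E] {μ : Measure α} {p : ℝ≥0∞} (hp0 : p ≠ 0) (hp : p ≠ ⊤)
    {F : ℕ → α → E} {g : α → ℝ} (hF : ∀ k, AEStronglyMeasurable (F k) μ) (hg : MemLp g p μ)
    (hb : ∀ k, ∀ᵐ x ∂μ, ‖F k x‖ ≤ g x)
    (hlim : ∀ᵐ x ∂μ, Tendsto (fun k => F k x) atTop (𝓝 0)) :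
    Tendsto (fun k => eLpNorm (F k) p μ) atTop (𝓝 0) := by
  have hpos : 0 < p.toReal := ENNReal.toReal_pos hp0 hp
  have key : Tendsto (fun k => ∫⁻ x, ‖F k x‖ₑ ^ p.toReal ∂μ) atTop (𝓝 (∫⁻ _, 0 ∂μ)) := by
    refine tendsto_lintegral_of_dominated_convergence' (fun x => ‖g x‖ₑ ^ p.toReal)
      (fun k => (hF k).enorm.pow_const _) ?_ ?_ ?_
    · intro k
      filter_upwards [hb k] with x hx
      gcongr
      exact enorm_le_iff_norm_le.2 (hx.trans (Real.le_norm_self _))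
    · exact (lintegral_rpow_enorm_lt_top_of_eLpNorm_lt_top hp0 hp hg.2).ne
    · filter_upwards [hlim] with x hx
      have h1 : Tendsto (fun k => ‖F k x‖ₑ) atTop (𝓝 0) := by
        simpa using hx.enorm
      simpa [hpos] using h1.ennrpow_const p.toReal
  simp only [lintegral_zero] at key
  have h2 := key.ennrpow_const (1 / p.toReal)
  rw [ENNReal.zero_rpow_of_pos (by positivity)] at h2
  refine h2.congr fun k => ?_
  rw [eLpNorm_eq_lintegral_rpow_enorm_toReal hp0 hp]

/-- Pairing against a fixed `L^q` field is continuous for `L^p` convergence. -/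
theorem tendsto_integral_inner_of_tendsto_eLpNorm {α E : Type*} [MeasurableSpace α]
    [NormedAddCommGroup E] [InnerProductSpace ℝ E] {μ : Measure α} {p q : ℝ≥0∞}
    [ENNReal.HolderConjugate p q] {A D : α → E} {F : ℕ → α → E} (hA : MemLp A q μ)
    (hD : MemLp D p μ) (hF : ∀ k, AEStronglyMeasurable (F k) μ)
    (hlim : Tendsto (fun k => eLpNorm (fun x => D x - F k x) p μ) atTop (𝓝 0)) :
    Tendsto (fun k => ∫ x, inner ℝ (A x) (F k x) ∂μ) atTop
      (𝓝 (∫ x, inner ℝ (A x) (D x) ∂μ)) := by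
  have hbound : ∀ H : α → E, AEStronglyMeasurable H μ →
      eLpNorm (fun x => inner ℝ (A x) (H x)) 1 μ ≤ eLpNorm A q μ * eLpNorm H p μ := by
    intro H hH
    have := eLpNorm_le_eLpNorm_mul_eLpNorm_of_nnnorm (p := q) (q := p) (r := 1) hA.1 hH
      (fun a b => inner ℝ a b) 1 (.of_forall fun x => by
        simpa using nnnorm_inner_le_nnnorm (𝕜 := ℝ) (A x) (H x))
    simpa using this
  have hint : Integrable (fun x => inner ℝ (A x) (D x)) μ := by
    rw [← memLp_one_iff_integrable]
    exact ⟨hA.1.inner hD.1, (hbound D hD.1).trans_lt (ENNReal.mul_lt_top hA.2 hD.2)⟩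
  refine tendsto_integral_of_L1' _ hint.1 ?_ ?_
  · have hfin : ∀ᶠ k in atTop, eLpNorm (fun x => D x - F k x) p μ < ⊤ :=
      (hlim.eventually (gt_mem_nhds (show (0 : ℝ≥0∞) < ⊤ by simp)))
    filter_upwards [hfin] with k hk
    have h2 : Integrable (fun x => inner ℝ (A x) (D x - F k x)) μ := by
      rw [← memLp_one_iff_integrable]
      exact ⟨hA.1.inner (hD.1.sub (hF k)), (hbound _ (hD.1.sub (hF k))).trans_lt
        (ENNReal.mul_lt_top hA.2 hk)⟩
    refine (hint.sub h2).congr (.of_forall fun x => ?_)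
    simp [inner_sub_right]
  · have h3 : Tendsto (fun k => eLpNorm A q μ * eLpNorm (fun x => D x - F k x) p μ) atTop (𝓝 0) := by
      simpa using ENNReal.Tendsto.const_mul hlim (Or.inr hA.2.ne)
    refine tendsto_of_tendsto_of_tendsto_of_le_of_le tendsto_const_nhds h3 (fun _ => zero_le) ?_
    intro k
    refine le_trans (le_of_eq ?_) (hbound _ (hD.1.sub (hF k)))
    refine eLpNorm_congr_norm_ae (.of_forall fun x => ?_)
    rw [← norm_neg]
    simp [inner_sub_right]

/-! ### Test functions, the chain rule and the Sobolev inequality in `W_0^{1,p}` -/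

theorem norm_gradient {H : Type*} [NormedAddCommGroup H] [InnerProductSpace ℝ H]
    [CompleteSpace H] (φ : H → ℝ) (x : H) : ‖gradient φ x‖ = ‖fderiv ℝ φ x‖ := by
  simp [gradient]

theorem IsTestFunction.continuous_gradient {n : ℕ} {Ω : Set (EuclideanSpace ℝ (Fin n))}
    {φ : EuclideanSpace ℝ (Fin n) → ℝ} (hφ : IsTestFunction Ω φ) : Continuous (gradient φ) :=
  (InnerProductSpace.toDual ℝ _).symm.continuous.comp
    (hφ.contDiff.continuous_fderiv (by simp))

theorem IsTestFunction.gradient_comp {n : ℕ} {Ω : Set (EuclideanSpace ℝ (Fin n))}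
    {φ : EuclideanSpace ℝ (Fin n) → ℝ} (hφ : IsTestFunction Ω φ) {F : ℝ → ℝ}
    (hF : ContDiff ℝ ∞ F) (x : EuclideanSpace ℝ (Fin n)) :
    gradient (fun y => F (φ y)) x = deriv F (φ x) • gradient φ x := by
  have h1 : HasFDerivAt (fun y => F (φ y)) (deriv F (φ x) • fderiv ℝ φ x) x :=
    ((hF.differentiable (by simp)) (φ x)).hasDerivAt.comp_hasFDerivAt x
      ((hφ.contDiff.differentiable (by simp)) x).hasFDerivAt
  simp [gradient, h1.fderiv]

theorem IsTestFunction.comp {n : ℕ} {Ω : Set (EuclideanSpace ℝ (Fin n))}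
    {φ : EuclideanSpace ℝ (Fin n) → ℝ} (hφ : IsTestFunction Ω φ) {F : ℝ → ℝ}
    (hF : ContDiff ℝ ∞ F) (hF0 : F 0 = 0) : IsTestFunction Ω (fun x => F (φ x)) where
  contDiff := hF.comp hφ.contDiff
  hasCompactSupport := hφ.hasCompactSupport.comp_left hF0
  tsupport_subset := (closure_mono (Function.support_comp_subset hF0 φ)).trans hφ.tsupport_subset

/-- The approximating test functions of a function in `W_0^{1,p}` may be taken to converge almost
everywhere. -/
theorem IsW1pZeroWithGrad.exists_seq_tendsto_ae {n : ℕ} {p : ℝ} (hp : 1 < p)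
    {Ω : Set (EuclideanSpace ℝ (Fin n))} {u : EuclideanSpace ℝ (Fin n) → ℝ}
    {G : EuclideanSpace ℝ (Fin n) → EuclideanSpace ℝ (Fin n)} (hu : IsW1pZeroWithGrad p Ω u G) :
    ∃ φ : ℕ → EuclideanSpace ℝ (Fin n) → ℝ, (∀ k, IsTestFunction Ω (φ k)) ∧
      (∀ᵐ x ∂(volume.restrict Ω), Tendsto (fun k => φ k x) atTop (𝓝 (u x))) ∧
      Tendsto (fun k => eLpNorm (fun x => G x - gradient (φ k) x) (ENNReal.ofReal p)
        (volume.restrict Ω)) atTop (𝓝 0) := by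
  obtain ⟨φ, hφ, h1, h2⟩ := hu.exists_approx
  have hm := tendstoInMeasure_of_tendsto_eLpNorm (l := atTop) (f := φ) (g := u)
    (μ := volume.restrict Ω) (p := ENNReal.ofReal p) (by simp; linarith)
    (fun k => (hφ k).contDiff.continuous.aestronglyMeasurable) hu.isW1p.memLp.1
    (h1.congr fun k => by
      refine eLpNorm_congr_norm_ae (.of_forall fun x => ?_)
      rw [← norm_neg]; simp)
  obtain ⟨ns, hns, hae⟩ := hm.exists_seq_tendsto_ae
  exact ⟨fun k => φ (ns k), fun k => hφ _, hae, h2.comp hns.tendsto_atTop⟩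

/-- The chain rule in the limit: if test functions `φ k` converge to `u` almost everywhere and
their gradients converge to `G` in `L^p`, then the gradients of `F ∘ φ k` converge to `F'(u) G`. -/
theorem tendsto_eLpNorm_deriv_smul_sub_gradient_comp {n : ℕ} {p : ℝ} (hp : 1 < p)
    {Ω : Set (EuclideanSpace ℝ (Fin n))} {u : EuclideanSpace ℝ (Fin n) → ℝ}
    {G : EuclideanSpace ℝ (Fin n) → EuclideanSpace ℝ (Fin n)}
    (hum : AEStronglyMeasurable u (volume.restrict Ω))
    (hG : MemLp G (ENNReal.ofReal p) (volume.restrict Ω))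
    {φ : ℕ → EuclideanSpace ℝ (Fin n) → ℝ} (hφ : ∀ k, IsTestFunction Ω (φ k))
    (hae : ∀ᵐ x ∂(volume.restrict Ω), Tendsto (fun k => φ k x) atTop (𝓝 (u x)))
    (hlim : Tendsto (fun k => eLpNorm (fun x => G x - gradient (φ k) x) (ENNReal.ofReal p)
        (volume.restrict Ω)) atTop (𝓝 0))
    {F : ℝ → ℝ} (hF : ContDiff ℝ ∞ F) {B : ℝ} (hB : ∀ t, |deriv F t| ≤ B) :
    Tendsto (fun k => eLpNorm (fun x => deriv F (u x) • G x - gradient (fun y => F (φ k y)) x)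
      (ENNReal.ofReal p) (volume.restrict Ω)) atTop (𝓝 0) := by
  have hB0 : 0 ≤ B := (abs_nonneg _).trans (hB 0)
  have hF' : Continuous (deriv F) := hF.continuous_deriv (by simp)
  have hp1 : 1 ≤ ENNReal.ofReal p := by simpa using hp.le
  have hφm : ∀ k, AEStronglyMeasurable (fun x => deriv F (φ k x)) (volume.restrict Ω) :=
    fun k => (hF'.comp (hφ k).contDiff.continuous).aestronglyMeasurable
  have hgm : ∀ k, AEStronglyMeasurable (gradient (φ k)) (volume.restrict Ω) :=
    fun k => (hφ k).continuous_gradient.aestronglyMeasurable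
  have hF'u : AEStronglyMeasurable (fun x => deriv F (u x)) (volume.restrict Ω) :=
    hF'.comp_aestronglyMeasurable hum
  have hdom : Tendsto (fun k => eLpNorm (fun x => (deriv F (u x) - deriv F (φ k x)) • G x)
      (ENNReal.ofReal p) (volume.restrict Ω)) atTop (𝓝 0) := by
    refine tendsto_eLpNorm_zero_of_dominated (by simp; linarith) (by simp)
      (g := fun x => (2 * B) * ‖G x‖) (fun k => (hF'u.sub (hφm k)).smul hG.1)
      (hG.norm.const_mul _) (fun k => .of_forall fun x => ?_) ?_
    · rw [norm_smul, Real.norm_eq_abs]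
      gcongr
      refine (abs_sub _ _).trans ?_
      linarith [hB (u x), hB (φ k x)]
    · filter_upwards [hae] with x hx
      have : Tendsto (fun k => deriv F (φ k x)) atTop (𝓝 (deriv F (u x))) :=
        (hF'.tendsto _).comp hx
      simpa using (this.const_sub (deriv F (u x))).smul_const (G x)
  have hsec : Tendsto (fun k => ENNReal.ofReal B * eLpNorm (fun x => G x - gradient (φ k) x)
      (ENNReal.ofReal p) (volume.restrict Ω)) atTop (𝓝 0) := by
    simpa using ENNReal.Tendsto.const_mul hlim (Or.inr ENNReal.ofReal_ne_top)
  refine tendsto_of_tendsto_of_tendsto_of_le_of_le tendsto_const_nhds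
    (by simpa using hdom.add hsec) (fun _ => zero_le) fun k => ?_
  have hsplit : (fun x => deriv F (u x) • G x - gradient (fun y => F (φ k y)) x) =
      (fun x => (deriv F (u x) - deriv F (φ k x)) • G x) +
        (fun x => deriv F (φ k x) • (G x - gradient (φ k) x)) := by
    ext1 x
    simp only [(hφ k).gradient_comp hF, Pi.add_apply, sub_smul, smul_sub]
    abel
  rw [hsplit]
  refine (eLpNorm_add_le ((hF'u.sub (hφm k)).smul hG.1) ((hφm k).smul (hG.1.sub (hgm k)))
    hp1).trans ?_
  refine add_le_add le_rfl ?_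
  refine eLpNorm_le_mul_eLpNorm_of_ae_le_mul (.of_forall fun x => ?_) _
  rw [Pi.smul_apply', norm_smul, Real.norm_eq_abs]
  exact mul_le_mul_of_nonneg_right (hB _) (norm_nonneg _)

/-- The flux `|G|^{p-2} G` of a field in `L^p` lies in the dual space. -/
theorem MeasureTheory.MemLp.norm_rpow_sub_two_smul {α E : Type*} [MeasurableSpace α]
    [NormedAddCommGroup E] [NormedSpace ℝ E] {μ : Measure α} {p q : ℝ}
    (hpq : p.HolderConjugate q) {G : α → E} (hG : MemLp G (ENNReal.ofReal p) μ) :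
    MemLp (fun x => ‖G x‖ ^ (p - 2) • G x) (ENNReal.ofReal q) μ := by
  have h1 := hG.norm_rpow_div (ENNReal.ofReal (p - 1))
  have hp := hpq.sub_one_pos
  rw [← ENNReal.ofReal_div_of_pos hp, ENNReal.toReal_ofReal hp.le, ← hpq.conjugate_eq] at h1
  refine h1.congr_norm
    ((hG.1.norm.aemeasurable.pow_const _).aestronglyMeasurable.smul hG.1)
    (.of_forall fun x => ?_)
  rw [norm_smul]
  by_cases hx : ‖G x‖ = 0
  · simp [hx, hp.ne']
  · have : 0 < ‖G x‖ := (norm_nonneg _).lt_of_ne' hx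
    rw [Real.norm_of_nonneg (by positivity), Real.norm_of_nonneg (by positivity),
      ← Real.rpow_add_one this.ne']
    congr 1; ring

/-- A bounded smooth function `F(u)` with `F(0) = 0` and bounded derivative is admissible in the
weak formulation. -/
theorem IsW1pZeroWithGrad.integral_deriv_mul_norm_rpow {n : ℕ} {p : ℝ} (hp : 1 < p)
    {Ω : Set (EuclideanSpace ℝ (Fin n))} {f u : EuclideanSpace ℝ (Fin n) → ℝ}
    {G : EuclideanSpace ℝ (Fin n) → EuclideanSpace ℝ (Fin n)} (hu : IsW1pZeroWithGrad p Ω u G)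
    (hf : Integrable f (volume.restrict Ω))
    (heq : ∀ φ : EuclideanSpace ℝ (Fin n) → ℝ, IsTestFunction Ω φ →
      ∫ x in Ω, ‖G x‖ ^ (p - 2) * inner ℝ (G x) (gradient φ x) = ∫ x in Ω, f x * φ x)
    {F : ℝ → ℝ} (hF : ContDiff ℝ ∞ F) (hF0 : F 0 = 0) {A B : ℝ} (hA : ∀ t, |F t| ≤ A)
    (hB : ∀ t, |deriv F t| ≤ B) :
    ∫ x in Ω, deriv F (u x) * ‖G x‖ ^ p = ∫ x in Ω, f x * F (u x) := by
  obtain ⟨φ, hφ, hae, hlim⟩ := hu.exists_seq_tendsto_ae hp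
  have hG := hu.isW1p.memLp_grad
  have hpq := Real.HolderConjugate.conjExponent hp
  have : ENNReal.HolderConjugate (ENNReal.ofReal p) (ENNReal.ofReal p.conjExponent) :=
    hpq.ennrealOfReal
  have hF' : Continuous (deriv F) := hF.continuous_deriv (by simp)
  have hF'u : AEStronglyMeasurable (fun x => deriv F (u x)) (volume.restrict Ω) :=
    hF'.comp_aestronglyMeasurable hu.isW1p.memLp.1
  have hD : MemLp (fun x => deriv F (u x) • G x) (ENNReal.ofReal p) (volume.restrict Ω) :=
    hG.of_le_mul (c := B) (hF'u.smul hG.1) (.of_forall fun x => by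
      rw [norm_smul, Real.norm_eq_abs]; gcongr; exact hB _)
  have h1 := tendsto_integral_inner_of_tendsto_eLpNorm (hG.norm_rpow_sub_two_smul hpq) hD
    (fun k => ((hφ k).comp hF hF0).continuous_gradient.aestronglyMeasurable)
    (tendsto_eLpNorm_deriv_smul_sub_gradient_comp hp hu.isW1p.memLp.1 hG hφ hae hlim hF hB)
  have h2 : Tendsto (fun k => ∫ x in Ω, f x * F (φ k x)) atTop (𝓝 (∫ x in Ω, f x * F (u x))) := by
    refine tendsto_integral_of_dominated_convergence (fun x => ‖f x‖ * A)
      (fun k => hf.1.mul (hF.continuous.comp (hφ k).contDiff.continuous).aestronglyMeasurable)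
      (hf.norm.mul_const _) (fun k => .of_forall fun x => ?_) ?_
    · rw [norm_mul]; gcongr; exact hA _
    · filter_upwards [hae] with x hx
      exact ((hF.continuous.tendsto _).comp hx).const_mul _
  have h3 : (fun k => ∫ x in Ω, f x * F (φ k x)) = fun k =>
      ∫ x in Ω, inner ℝ (‖G x‖ ^ (p - 2) • G x) (gradient (fun y => F (φ k y)) x) := by
    ext1 k
    rw [← heq _ ((hφ k).comp hF hF0)]
    refine integral_congr_ae (.of_forall fun x => ?_)
    simp only [real_inner_smul_left]
  rw [h3] at h2
  rw [← tendsto_nhds_unique h1 h2]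
  refine integral_congr_ae (.of_forall fun x => ?_)
  simp only [real_inner_smul_left, real_inner_smul_right, real_inner_self_eq_norm_sq]
  by_cases hx : ‖G x‖ = 0
  · simp [hx, (by linarith : p ≠ 0)]
  · have : 0 < ‖G x‖ := (norm_nonneg _).lt_of_ne' hx
    have h4 : ‖G x‖ ^ p = ‖G x‖ ^ (p - 2) * ‖G x‖ ^ 2 := by
      rw [← Real.rpow_natCast, ← Real.rpow_add this]; norm_num
    rw [h4]

/-- The Gagliardo–Nirenberg–Sobolev inequality for a smooth function of `u ∈ W_0^{1,p}`. -/
theorem exists_eLpNorm_comp_le_eLpNorm_deriv_smul {n : ℕ} {p : ℝ} (hp : 1 < p) (hpn : p < n) :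
    ∃ S : ℝ≥0, ∀ (Ω : Set (EuclideanSpace ℝ (Fin n))) (u : EuclideanSpace ℝ (Fin n) → ℝ)
      (G : EuclideanSpace ℝ (Fin n) → EuclideanSpace ℝ (Fin n)), IsW1pZeroWithGrad p Ω u G →
      ∀ (Φ : ℝ → ℝ) (B : ℝ), ContDiff ℝ ∞ Φ → Φ 0 = 0 → (∀ t, |deriv Φ t| ≤ B) →
      eLpNorm (fun x => Φ (u x)) (ENNReal.ofReal (n * p / (n - p))) (volume.restrict Ω) ≤
        S * eLpNorm (fun x => deriv Φ (u x) • G x) (ENNReal.ofReal p) (volume.restrict Ω) := by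
  refine ⟨SNormLESNormFDerivOfEqConst ℝ (volume : Measure (EuclideanSpace ℝ (Fin n)))
    (Real.toNNReal p), ?_⟩
  set S := SNormLESNormFDerivOfEqConst ℝ (volume : Measure (EuclideanSpace ℝ (Fin n)))
    (Real.toNNReal p)
  intro Ω u G hu Φ B hΦ hΦ0 hB
  obtain ⟨φ, hφ, hae, hlim⟩ := hu.exists_seq_tendsto_ae hp
  have hp0 : 0 < p := by linarith
  have hn0 : (0 : ℝ) < n := hp0.trans hpn
  have hΦ' : Continuous (deriv Φ) := hΦ.continuous_deriv (by simp)
  have hψ := fun k => (hφ k).comp hΦ hΦ0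
  have hDm : AEStronglyMeasurable (fun x => deriv Φ (u x) • G x) (volume.restrict Ω) :=
    (hΦ'.comp_aestronglyMeasurable hu.isW1p.memLp.1).smul hu.isW1p.memLp_grad.1
  have hconv := tendsto_eLpNorm_deriv_smul_sub_gradient_comp hp hu.isW1p.memLp.1
    hu.isW1p.memLp_grad hφ hae hlim hΦ hB
  have hk : ∀ k, eLpNorm (fun x => Φ (φ k x)) (ENNReal.ofReal (n * p / (n - p)))
      (volume.restrict Ω) ≤ S * (eLpNorm (fun x => deriv Φ (u x) • G x) (ENNReal.ofReal p)
        (volume.restrict Ω) + eLpNorm (fun x => deriv Φ (u x) • G x -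
          gradient (fun y => Φ (φ k y)) x) (ENNReal.ofReal p) (volume.restrict Ω)) := by
    intro k
    have hsob := eLpNorm_le_eLpNorm_fderiv_of_eq
      (volume : Measure (EuclideanSpace ℝ (Fin n))) (u := fun x => Φ (φ k x))
      (p := Real.toNNReal p) (p' := Real.toNNReal (n * p / (n - p)))
      ((hψ k).contDiff.of_le (by simp)) (hψ k).hasCompactSupport
      (by simpa using hp.le) (by simpa using (by exact_mod_cast hn0 : 0 < n)) (by
        have : 0 < (n : ℝ) - p := by linarith
        rw [NNReal.coe_inv, Real.coe_toNNReal _ (by positivity), Real.coe_toNNReal _ hp0.le]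
        simp only [finrank_euclideanSpace, Fintype.card_fin]
        field_simp)
    have hgr : eLpNorm (fderiv ℝ (fun x => Φ (φ k x))) (ENNReal.ofReal p) volume =
        eLpNorm (gradient (fun x => Φ (φ k x))) (ENNReal.ofReal p) (volume.restrict Ω) := by
      rw [eLpNorm_restrict_eq_of_support_subset]
      · exact eLpNorm_congr_norm_ae (.of_forall fun x => (norm_gradient _ x).symm)
      · intro x hx
        refine (hψ k).tsupport_subset (support_fderiv_subset ℝ ?_)
        simp only [Function.mem_support, ne_eq] at hx ⊢
        contrapose! hx
        rw [← norm_eq_zero, norm_gradient, hx, norm_zero]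
    refine (eLpNorm_mono_measure _ Measure.restrict_le_self).trans (hsob.trans ?_)
    change (S : ℝ≥0∞) * eLpNorm _ (ENNReal.ofReal p) volume ≤ _
    rw [hgr]
    gcongr
    have hgm := (hψ k).continuous_gradient.aestronglyMeasurable (μ := volume.restrict Ω)
    have := eLpNorm_sub_le (p := ENNReal.ofReal p) hDm (hDm.sub hgm) (by simpa using hp.le)
    refine le_trans (le_of_eq ?_) this
    congr 1
    ext1 x
    simp
  have hfat := Lp.eLpNorm_lim_le_liminf_eLpNorm (p := ENNReal.ofReal (n * p / (n - p)))
    (μ := volume.restrict Ω) (f := fun k x => Φ (φ k x))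
    (fun k => (hψ k).contDiff.continuous.aestronglyMeasurable) (fun x => Φ (u x)) (by
      filter_upwards [hae] with x hx
      exact (hΦ.continuous.tendsto _).comp hx)
  refine hfat.trans ?_
  refine (liminf_le_liminf (.of_forall hk)).trans (le_of_eq ?_)
  refine Tendsto.liminf_eq ?_
  have := ENNReal.Tendsto.const_mul (a := (S : ℝ≥0∞)) (tendsto_const_nhds
    (x := eLpNorm (fun x => deriv Φ (u x) • G x) (ENNReal.ofReal p) (volume.restrict Ω))
    |>.add hconv) (Or.inr ENNReal.coe_ne_top)
  simpa using this

/-! ### Smooth powers and truncations -/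

/-- The smooth odd function `s (1 + s²)^{γ/2}`, which behaves like `s |s|^γ` at infinity. -/
noncomputable def smoothPower (γ s : ℝ) : ℝ := s * (1 + s ^ 2) ^ (γ / 2)

@[simp] theorem smoothPower_zero (γ : ℝ) : smoothPower γ 0 = 0 := by simp [smoothPower]

theorem contDiff_smoothPower (γ : ℝ) : ContDiff ℝ ∞ (smoothPower γ) := by
  unfold smoothPower
  exact contDiff_id.mul ((contDiff_const.add (contDiff_id.pow 2)).rpow_const_of_ne
    fun s => by simp only [id]; positivity)

theorem deriv_smoothPower (γ s : ℝ) :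
    deriv (smoothPower γ) s = (1 + s ^ 2) ^ (γ / 2) * ((1 + (1 + γ) * s ^ 2) / (1 + s ^ 2)) := by
  have h0 : 0 < 1 + s ^ 2 := by positivity
  have h1 : HasDerivAt (fun s : ℝ => 1 + s ^ 2) (2 * s) s := by
    simpa using (hasDerivAt_pow 2 s).const_add 1
  have h2 := (hasDerivAt_id s).mul (h1.rpow_const (p := γ / 2) (Or.inl h0.ne'))
  have h3 : deriv (smoothPower γ) s = _ := h2.deriv
  rw [h3, Real.rpow_sub_one h0.ne']
  simp only [id]
  field_simp
  ring

theorem deriv_smoothPower_le (γ s : ℝ) :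
    deriv (smoothPower γ) s ≤ max 1 (1 + γ) * (1 + s ^ 2) ^ (γ / 2) := by
  have h0 : 0 < 1 + s ^ 2 := by positivity
  rw [deriv_smoothPower, mul_comm]
  gcongr
  rw [div_le_iff₀ h0]
  nlinarith [le_max_left 1 (1 + γ), mul_le_mul_of_nonneg_right (le_max_right 1 (1 + γ)) (sq_nonneg s)]

theorem le_deriv_smoothPower (γ s : ℝ) :
    min 1 (1 + γ) * (1 + s ^ 2) ^ (γ / 2) ≤ deriv (smoothPower γ) s := by
  have h0 : 0 < 1 + s ^ 2 := by positivity
  rw [deriv_smoothPower, mul_comm]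
  gcongr
  rw [le_div_iff₀ h0]
  nlinarith [min_le_left 1 (1 + γ), mul_le_mul_of_nonneg_right (min_le_right 1 (1 + γ)) (sq_nonneg s)]

theorem deriv_smoothPower_nonneg {γ : ℝ} (hγ : -1 ≤ γ) (s : ℝ) : 0 ≤ deriv (smoothPower γ) s :=
  le_trans (mul_nonneg (le_min zero_le_one (by linarith)) (by positivity)) (le_deriv_smoothPower γ s)

theorem abs_smoothPower (γ s : ℝ) : |smoothPower γ s| = |s| * (1 + s ^ 2) ^ (γ / 2) := by
  rw [smoothPower, abs_mul, abs_of_nonneg (by positivity : 0 ≤ (1 + s ^ 2) ^ (γ / 2))]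

theorem one_add_sq_rpow_split (γ s : ℝ) :
    (1 + s ^ 2) ^ ((γ + 1) / 2) = √(1 + s ^ 2) * (1 + s ^ 2) ^ (γ / 2) := by
  rw [Real.sqrt_eq_rpow, ← Real.rpow_add (by positivity)]
  congr 1; ring

theorem abs_smoothPower_le (γ s : ℝ) : |smoothPower γ s| ≤ (1 + s ^ 2) ^ ((γ + 1) / 2) := by
  rw [abs_smoothPower, one_add_sq_rpow_split]
  gcongr
  exact Real.abs_le_sqrt (by linarith)

/-- Up to constants, `smoothPower` is bounded below by the full power of `√(1 + s²)`. -/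
theorem one_add_sq_rpow_le {γ : ℝ} (hγ : -1 ≤ γ) (s : ℝ) :
    (1 + s ^ 2) ^ ((γ + 1) / 2) ≤ 2 ^ ((γ + 1) / 2) + 2 * |smoothPower γ s| := by
  rcases le_total |s| 1 with h | h
  · have : s ^ 2 ≤ 1 := by rwa [sq_le_one_iff_abs_le_one]
    refine le_add_of_le_of_nonneg ?_ (by positivity)
    exact Real.rpow_le_rpow (by positivity) (by linarith) (by linarith)
  · refine le_add_of_nonneg_of_le (by positivity) ?_
    rw [abs_smoothPower, one_add_sq_rpow_split, ← mul_assoc]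
    gcongr
    rw [Real.sqrt_le_left (by positivity), mul_pow, sq_abs]
    have : 1 ≤ s ^ 2 := by rwa [one_le_sq_iff_one_le_abs]
    linarith

/-- A smooth truncation at height `1/ε`: the function `t / √(1 + (εt)²)`. -/
noncomputable def smoothTrunc (ε t : ℝ) : ℝ := smoothPower (-1) (ε * t) / ε

theorem contDiff_smoothTrunc (ε : ℝ) : ContDiff ℝ ∞ (smoothTrunc ε) :=
  ((contDiff_smoothPower _).comp (contDiff_const.mul contDiff_id)).div_const _

@[simp] theorem smoothTrunc_zero (ε : ℝ) : smoothTrunc ε 0 = 0 := by simp [smoothTrunc]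

theorem abs_smoothTrunc_le {ε : ℝ} (hε : 0 < ε) (t : ℝ) : |smoothTrunc ε t| ≤ 1 / ε := by
  rw [smoothTrunc, abs_div, abs_of_pos hε]
  gcongr
  simpa using abs_smoothPower_le (-1) (ε * t)

theorem smoothTrunc_eq {ε : ℝ} (hε : 0 < ε) (t : ℝ) :
    smoothTrunc ε t = t * (1 + (ε * t) ^ 2) ^ (-1 / 2 : ℝ) := by
  rw [smoothTrunc, smoothPower]; field_simp

theorem deriv_smoothTrunc {ε : ℝ} (hε : 0 < ε) (t : ℝ) :
    deriv (smoothTrunc ε) t = deriv (smoothPower (-1)) (ε * t) := by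
  have h1 : HasDerivAt (smoothPower (-1)) (deriv (smoothPower (-1)) (ε * t)) (ε * t) :=
    ((contDiff_smoothPower (-1)).differentiable (by simp) _).hasDerivAt
  have h2 : HasDerivAt (fun t => ε * t) ε t := by simpa using (hasDerivAt_id t).const_mul ε
  have h3 : deriv (smoothTrunc ε) t = _ := ((h1.comp t h2).div_const ε).deriv
  rw [h3]; field_simp

theorem deriv_smoothTrunc_nonneg {ε : ℝ} (hε : 0 < ε) (t : ℝ) : 0 ≤ deriv (smoothTrunc ε) t := by
  rw [deriv_smoothTrunc hε]; exact deriv_smoothPower_nonneg le_rfl _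

theorem deriv_smoothTrunc_le_one {ε : ℝ} (hε : 0 < ε) (t : ℝ) : deriv (smoothTrunc ε) t ≤ 1 := by
  rw [deriv_smoothTrunc hε]
  refine (deriv_smoothPower_le _ _).trans ?_
  simpa using Real.rpow_le_one_of_one_le_of_nonpos
    (by nlinarith [sq_nonneg (ε * t)] : (1 : ℝ) ≤ 1 + (ε * t) ^ 2) (by norm_num : (-1 / 2 : ℝ) ≤ 0)

theorem tendsto_smoothTrunc (t : ℝ) :
    Tendsto (fun k : ℕ => smoothTrunc (1 / ((k : ℝ) + 1)) t) atTop (𝓝 t) := by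
  have h : ∀ k : ℕ, smoothTrunc (1 / ((k : ℝ) + 1)) t =
      t * (1 + (1 / ((k : ℝ) + 1) * t) ^ 2) ^ (-1 / 2 : ℝ) := fun k =>
    smoothTrunc_eq (by positivity) t
  simp_rw [h]
  have h1 : Tendsto (fun k : ℕ => 1 + (1 / ((k : ℝ) + 1) * t) ^ 2) atTop (𝓝 1) := by
    simpa using ((tendsto_one_div_add_atTop_nhds_zero_nat.mul_const t).pow 2).const_add (1 : ℝ)
  simpa using (h1.rpow_const (p := (-1 / 2 : ℝ)) (Or.inl one_ne_zero)).const_mul t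

theorem deriv_smoothPower_comp_smoothTrunc (γ ε t : ℝ) :
    deriv (fun t => smoothPower γ (smoothTrunc ε t)) t =
      deriv (smoothPower γ) (smoothTrunc ε t) * deriv (smoothTrunc ε) t :=
  deriv_comp t ((contDiff_smoothPower γ).differentiable (by simp) _)
    ((contDiff_smoothTrunc ε).differentiable (by simp) _)

/-- Since the truncation is bounded, a continuous function of it is bounded. -/
theorem exists_abs_comp_smoothTrunc_le {ε : ℝ} (hε : 0 < ε) {g : ℝ → ℝ} (hg : Continuous g) :
    ∃ A, ∀ t, |g (smoothTrunc ε t)| ≤ A := by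
  obtain ⟨A, hA⟩ := (isCompact_Icc (a := -(1 / ε)) (b := 1 / ε)).exists_bound_of_continuousOn
    hg.continuousOn
  exact ⟨A, fun t => hA _ (abs_le.1 (abs_smoothTrunc_le hε t))⟩

theorem exists_abs_deriv_smoothPower_comp_smoothTrunc_le (γ : ℝ) {ε : ℝ} (hε : 0 < ε) :
    ∃ B, ∀ t, |deriv (fun t => smoothPower γ (smoothTrunc ε t)) t| ≤ B := by
  obtain ⟨B, hB⟩ := exists_abs_comp_smoothTrunc_le hε
    ((contDiff_smoothPower γ).continuous_deriv (by simp))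
  refine ⟨B, fun t => ?_⟩
  rw [deriv_smoothPower_comp_smoothTrunc, abs_mul, abs_of_nonneg (deriv_smoothTrunc_nonneg hε t)]
  exact (mul_le_of_le_one_right (abs_nonneg _) (deriv_smoothTrunc_le_one hε t)).trans (hB t)

/-- The pointwise inequality `(Φ')^p ≤ K F'` between the two nonlinearities used to test the
equation. -/
theorem abs_deriv_rpow_le {p δ : ℝ} (hp : 1 ≤ p) (hδ : -1 ≤ δ) (hγ : -1 < p * δ) {ε : ℝ}
    (hε : 0 < ε) (t : ℝ) :
    |deriv (fun t => smoothPower δ (smoothTrunc ε t)) t| ^ p ≤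
      (max 1 (1 + δ) ^ p / min 1 (1 + p * δ)) *
        deriv (fun t => smoothPower (p * δ) (smoothTrunc ε t)) t := by
  rw [deriv_smoothPower_comp_smoothTrunc, deriv_smoothPower_comp_smoothTrunc]
  set T := smoothTrunc ε t
  set d := deriv (smoothTrunc ε) t
  have hd0 : 0 ≤ d := deriv_smoothTrunc_nonneg hε t
  have hd1 : d ≤ 1 := deriv_smoothTrunc_le_one hε t
  have hD0 := deriv_smoothPower_nonneg hδ T
  have hm : 0 < min 1 (1 + p * δ) := lt_min one_pos (by linarith)
  have hw : 0 < 1 + T ^ 2 := by positivity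
  rw [abs_of_nonneg (mul_nonneg hD0 hd0), Real.mul_rpow hD0 hd0, ← mul_assoc]
  have h1 : d ^ p ≤ d := by
    simpa using Real.rpow_le_rpow_of_exponent_ge' hd0 hd1 zero_le_one hp
  have h2 : deriv (smoothPower δ) T ^ p ≤ max 1 (1 + δ) ^ p * (1 + T ^ 2) ^ (p * δ / 2) := by
    refine (Real.rpow_le_rpow hD0 (deriv_smoothPower_le δ T) (by linarith)).trans_eq ?_
    rw [Real.mul_rpow (by positivity) (by positivity), ← Real.rpow_mul hw.le]
    congr 2; ring
  have h3 : max 1 (1 + δ) ^ p * (1 + T ^ 2) ^ (p * δ / 2) ≤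
      max 1 (1 + δ) ^ p / min 1 (1 + p * δ) * deriv (smoothPower (p * δ)) T := by
    rw [div_mul_eq_mul_div, le_div_iff₀ hm, mul_assoc]
    gcongr
    rw [mul_comm]
    exact le_deriv_smoothPower _ _
  exact mul_le_mul (h2.trans h3) h1 (by positivity)
    (mul_nonneg (by positivity) (deriv_smoothPower_nonneg hγ.le T))

/-! ### The energy estimate and homogeneity -/

/-- The basic estimate: testing with `F(u)`, the Sobolev inequality for `Φ(u)` and Hölder's
inequality, for nonlinearities with `|Φ'|^p ≤ K F'`. -/
theorem exists_eLpNorm_comp_rpow_le {n : ℕ} {p : ℝ} (hp : 1 < p) (hpn : p < n) :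
    ∃ S : ℝ≥0, ∀ (Ω : Set (EuclideanSpace ℝ (Fin n))), volume Ω < ⊤ →
      ∀ (f u : EuclideanSpace ℝ (Fin n) → ℝ) (q q' : ℝ), q.HolderConjugate q' →
      MemLp f (ENNReal.ofReal q) (volume.restrict Ω) → IsWeakSolution p Ω f u →
      ∀ (F Φ : ℝ → ℝ) (A B B' K : ℝ), ContDiff ℝ ∞ F → ContDiff ℝ ∞ Φ → F 0 = 0 → Φ 0 = 0 →
        (∀ t, |F t| ≤ A) → (∀ t, |deriv F t| ≤ B) → (∀ t, |deriv Φ t| ≤ B') → 0 ≤ K →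
        (∀ t, |deriv Φ t| ^ p ≤ K * deriv F t) →
        eLpNorm (fun x => Φ (u x)) (ENNReal.ofReal (n * p / (n - p))) (volume.restrict Ω) ^ p ≤
          (S : ℝ≥0∞) ^ p * (ENNReal.ofReal K * (eLpNorm f (ENNReal.ofReal q) (volume.restrict Ω) *
            eLpNorm (fun x => F (u x)) (ENNReal.ofReal q') (volume.restrict Ω))) := by
  obtain ⟨S, hS⟩ := exists_eLpNorm_comp_le_eLpNorm_deriv_smul hp hpn
  refine ⟨S, ?_⟩
  intro Ω hΩ f u q q' hqq hf ⟨G, hu, heq⟩ F Φ A B B' K hF hΦ hF0 hΦ0 hA hB hB' hK hFΦ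
  have hp0 : 0 < p := by linarith
  have hfin : IsFiniteMeasure (volume.restrict Ω) := ⟨by simpa using hΩ⟩
  have : ENNReal.HolderConjugate (ENNReal.ofReal q) (ENNReal.ofReal q') := hqq.ennrealOfReal
  have hfi : Integrable f (volume.restrict Ω) := hf.integrable (by simpa using hqq.lt.le)
  have hum := hu.isW1p.memLp.1
  have hFu : AEStronglyMeasurable (fun x => F (u x)) (volume.restrict Ω) :=
    hF.continuous.comp_aestronglyMeasurable hum
  have hF'u : AEStronglyMeasurable (fun x => deriv F (u x)) (volume.restrict Ω) :=
    (hF.continuous_deriv (by simp)).comp_aestronglyMeasurable hum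
  have hF'0 : ∀ t, 0 ≤ deriv F t ∨ K = 0 := by
    intro t
    by_contra! h
    have h1 := hFΦ t
    have h2 : 0 < K := hK.lt_of_ne' h.2
    have h3 : 0 ≤ |deriv Φ t| ^ p := by positivity
    nlinarith [mul_pos h2 (neg_pos.2 h.1)]
  have hGp : Integrable (fun x => ‖G x‖ ^ p) (volume.restrict Ω) := by
    have := hu.isW1p.memLp_grad.integrable_norm_rpow (by simpa using hp0) (by simp)
    simpa [ENNReal.toReal_ofReal hp0.le] using this
  have hint : Integrable (fun x => K * (deriv F (u x) * ‖G x‖ ^ p)) (volume.restrict Ω) := by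
    refine Integrable.const_mul ?_ _
    refine (hGp.const_mul B).mono (hF'u.mul hGp.1) (.of_forall fun x => ?_)
    rw [norm_mul, norm_mul]
    gcongr
    exact (hB _).trans (le_abs_self _)
  have h1 : eLpNorm (fun x => deriv Φ (u x) • G x) (ENNReal.ofReal p) (volume.restrict Ω) ^ p ≤
      ENNReal.ofReal (∫ x in Ω, K * (deriv F (u x) * ‖G x‖ ^ p)) := by
    rw [eLpNorm_eq_lintegral_rpow_enorm_toReal (by simpa using hp0) (by simp),
      ENNReal.toReal_ofReal hp0.le, ← ENNReal.rpow_mul, one_div_mul_cancel hp0.ne',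
      ENNReal.rpow_one, ofReal_integral_eq_lintegral_ofReal hint]
    · refine lintegral_mono fun x => ?_
      rw [← ofReal_norm, ENNReal.ofReal_rpow_of_nonneg (norm_nonneg _) hp0.le]
      refine ENNReal.ofReal_le_ofReal ?_
      rw [norm_smul, Real.mul_rpow (norm_nonneg _) (norm_nonneg _), ← mul_assoc]
      gcongr
      exact hFΦ _
    · refine .of_forall fun x => ?_
      rcases hF'0 (u x) with h | h
      · change 0 ≤ K * (deriv F (u x) * ‖G x‖ ^ p)
        positivity
      · simp [h]
  have h2 : ENNReal.ofReal (∫ x in Ω, K * (deriv F (u x) * ‖G x‖ ^ p)) ≤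
      ENNReal.ofReal K * (eLpNorm f (ENNReal.ofReal q) (volume.restrict Ω) *
            eLpNorm (fun x => F (u x)) (ENNReal.ofReal q') (volume.restrict Ω)) := by
    rw [integral_const_mul, hu.integral_deriv_mul_norm_rpow hp hfi heq hF hF0 hA hB,
      ENNReal.ofReal_mul hK]
    gcongr
    refine (ENNReal.ofReal_le_ofReal (Real.le_norm_self _)).trans ?_
    rw [ofReal_norm]
    refine (enorm_integral_le_lintegral_enorm _).trans ?_
    rw [← eLpNorm_one_eq_lintegral_enorm]
    simpa using eLpNorm_le_eLpNorm_mul_eLpNorm_of_nnnorm (p := ENNReal.ofReal q)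
      (q := ENNReal.ofReal q') (r := 1) hf.1 hFu (fun a b => a * b) 1
      (.of_forall fun x => by simp)
  calc _ ≤ (S * eLpNorm (fun x => deriv Φ (u x) • G x) (ENNReal.ofReal p)
        (volume.restrict Ω)) ^ p := by
        gcongr
        exact hS Ω u G hu Φ B' hΦ hΦ0 hB'
    _ = (S : ℝ≥0∞) ^ p * eLpNorm (fun x => deriv Φ (u x) • G x) (ENNReal.ofReal p)
        (volume.restrict Ω) ^ p := ENNReal.mul_rpow_of_nonneg _ _ hp0.le
    _ ≤ _ := by
        gcongr
        exact h1.trans h2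

/-- A sublinear self-bound `W ≤ D (1 + W^θ)`, `θ < 1`, absorbs into a bound. -/
theorem le_of_le_mul_one_add_rpow {W : ℝ≥0∞} (hW : W ≠ ⊤) {D : ℝ≥0∞} {θ : ℝ} (hθ0 : 0 ≤ θ)
    (hθ : θ < 1) (h : W ≤ D * (1 + W ^ θ)) : W ≤ max 1 ((D * 2) ^ (1 / (1 - θ))) := by
  rcases le_total W 1 with h1 | h1
  · exact h1.trans (le_max_left _ _)
  · refine le_trans ?_ (le_max_right _ _)
    have hW0 : W ≠ 0 := (one_pos.trans_le h1).ne'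
    have h2 : W ≤ D * 2 * W ^ θ := by
      refine h.trans ?_
      rw [mul_assoc, two_mul]
      gcongr
      simpa using ENNReal.rpow_le_rpow h1 hθ0
    have h3 : W ^ (1 - θ) ≤ D * 2 := by
      rw [ENNReal.rpow_sub _ _ hW0 hW, ENNReal.rpow_one]
      exact ENNReal.div_le_of_le_mul h2
    have h4 := ENNReal.rpow_le_rpow h3 (by
      have : 0 < 1 - θ := by linarith
      positivity : 0 ≤ 1 / (1 - θ))
    rwa [← ENNReal.rpow_mul, mul_one_div_cancel (by linarith), ENNReal.rpow_one] at h4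

/-- Multiples of weak solutions solve the equation with a rescaled datum. -/
theorem IsWeakSolution.const_mul {n : ℕ} {p : ℝ} {Ω : Set (EuclideanSpace ℝ (Fin n))}
    {f u : EuclideanSpace ℝ (Fin n) → ℝ} (h : IsWeakSolution p Ω f u) {c : ℝ} (hc : 0 < c) :
    IsWeakSolution p Ω (fun x => c ^ (p - 1) * f x) (fun x => c * u x) := by
  obtain ⟨G, hu, heq⟩ := h
  refine ⟨fun x => c • G x, ⟨⟨hu.isW1p.memLp.const_mul c, hu.isW1p.memLp_grad.const_smul c, ?_⟩,
    ?_⟩, ?_⟩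
  · intro φ hφ v
    have := hu.isW1p.integral_by_parts φ hφ v
    simp only [mul_assoc, real_inner_smul_left]
    rw [integral_const_mul, this, mul_neg, ← integral_const_mul]
    congr 2
    ext1 x
    ring
  · obtain ⟨φ, hφ, h1, h2⟩ := hu.exists_approx
    have hcomp : ContDiff ℝ ∞ (fun t : ℝ => c * t) := contDiff_const.mul contDiff_id
    refine ⟨fun k x => c * φ k x, fun k => (hφ k).comp hcomp (by simp), ?_, ?_⟩
    · have : ∀ k, (fun x => c * u x - c * φ k x) = c • fun x => u x - φ k x := by
        intro k; ext1 x; simp [mul_sub]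
      simp_rw [this, eLpNorm_const_smul]
      simpa using ENNReal.Tendsto.const_mul h1 (Or.inr enorm_ne_top)
    · have : ∀ k, (fun x => c • G x - gradient (fun x => c * φ k x) x) =
          c • fun x => G x - gradient (φ k) x := by
        intro k; ext1 x
        have hd : deriv (fun t : ℝ => c * t) (φ k x) = c := by simp
        rw [(hφ k).gradient_comp hcomp, hd, Pi.smul_apply, smul_sub]
      simp_rw [this, eLpNorm_const_smul]
      simpa using ENNReal.Tendsto.const_mul h2 (Or.inr enorm_ne_top)
  · intro φ hφ
    have := heq φ hφ
    simp only [mul_assoc, real_inner_smul_left]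
    rw [integral_const_mul, ← this, ← integral_const_mul]
    congr 1
    ext1 x
    rw [norm_smul, Real.norm_of_nonneg hc.le, Real.mul_rpow hc.le (norm_nonneg _)]
    have : c ^ (p - 1) = c ^ (p - 2) * c := by
      rw [← Real.rpow_add_one hc.ne']; congr 1; ring
    rw [this]; ring

/-- By homogeneity it suffices to prove the estimate for data of norm at most one. -/
theorem eLpNorm_le_of_unit_data {n : ℕ} {p q r : ℝ} (hp : 1 < p)
    {Ω : Set (EuclideanSpace ℝ (Fin n))} {C : ℝ≥0}
    (hC : ∀ f u : EuclideanSpace ℝ (Fin n) → ℝ,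
      MemLp f (ENNReal.ofReal q) (volume.restrict Ω) → IsWeakSolution p Ω f u →
      eLpNorm f (ENNReal.ofReal q) (volume.restrict Ω) ≤ 1 →
      eLpNorm u (ENNReal.ofReal r) (volume.restrict Ω) ≤ C)
    {f u : EuclideanSpace ℝ (Fin n) → ℝ} (hf : MemLp f (ENNReal.ofReal q) (volume.restrict Ω))
    (hu : IsWeakSolution p Ω f u) :
    eLpNorm u (ENNReal.ofReal r) (volume.restrict Ω) ≤
      C * eLpNorm f (ENNReal.ofReal q) (volume.restrict Ω) ^ (1 / (p - 1)) := by
  have hp1 : 0 < p - 1 := by linarith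
  have key : ∀ c : ℝ≥0, 0 < c → eLpNorm f (ENNReal.ofReal q) (volume.restrict Ω) ≤ c →
      eLpNorm u (ENNReal.ofReal r) (volume.restrict Ω) ≤ C * (c : ℝ≥0∞) ^ (1 / (p - 1)) := by
    intro c hc hfc
    set d : ℝ := (c : ℝ) ^ (-(1 / (p - 1))) with hd
    have hc' : (0 : ℝ) < c := hc
    have hd0 : 0 < d := by positivity
    have hdp : d ^ (p - 1) = (c : ℝ)⁻¹ := by
      rw [hd, ← Real.rpow_mul hc'.le, ← Real.rpow_neg_one]
      congr 1; field_simp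
    have h := hC _ _ (hf.const_mul (d ^ (p - 1))) (hu.const_mul hd0) ?_
    · change eLpNorm (d • u) _ _ ≤ _ at h
      rw [eLpNorm_const_smul] at h
      have hde : ‖d‖ₑ * (c : ℝ≥0∞) ^ (1 / (p - 1)) = 1 := by
        rw [Real.enorm_of_nonneg hd0.le, hd, ← ENNReal.ofReal_rpow_of_pos hc',
          ENNReal.ofReal_coe_nnreal, ← ENNReal.rpow_add _ _ (by simpa using hc.ne') (by simp)]
        simp
      calc _ = ‖d‖ₑ * eLpNorm u (ENNReal.ofReal r) (volume.restrict Ω) *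
            (c : ℝ≥0∞) ^ (1 / (p - 1)) := by rw [mul_right_comm, hde, one_mul]
        _ ≤ _ := by gcongr
    · change eLpNorm ((d ^ (p - 1)) • f) _ _ ≤ _
      rw [eLpNorm_const_smul, hdp, enorm_inv hc'.ne', Real.enorm_of_nonneg hc'.le,
        ENNReal.ofReal_coe_nnreal]
      calc _ ≤ (c : ℝ≥0∞)⁻¹ * c := by gcongr
        _ ≤ 1 := ENNReal.inv_mul_le_one _
  set N := eLpNorm f (ENNReal.ofReal q) (volume.restrict Ω)
  have hN : N ≠ ⊤ := hf.2.ne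
  have hlim : Tendsto (fun k : ℕ => (C : ℝ≥0∞) *
      ((N.toNNReal + 1 / ((k : ℝ≥0) + 1) : ℝ≥0) : ℝ≥0∞) ^ (1 / (p - 1))) atTop
      (𝓝 (C * N ^ (1 / (p - 1)))) := by
    refine ENNReal.Tendsto.const_mul ?_ (Or.inr (by simp))
    refine Tendsto.ennrpow_const _ ?_
    have : Tendsto (fun k : ℕ => (N.toNNReal + 1 / ((k : ℝ≥0) + 1) : ℝ≥0)) atTop
        (𝓝 N.toNNReal) := by
      simpa using (tendsto_one_div_add_atTop_nhds_zero_nat (𝕜 := ℝ≥0)).const_add N.toNNReal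
    simpa [ENNReal.coe_toNNReal hN] using ENNReal.tendsto_coe.2 this
  refine ge_of_tendsto' hlim fun k => key _ (by positivity) ?_
  rw [ENNReal.coe_add, ENNReal.coe_toNNReal hN]
  exact le_self_add

/-! ### The a priori estimate -/

/-- The a priori bound at the critical exponent `s = (p-1)qn/(n-pq)`, for data of norm at most
one: the truncations of `u` are tested with powers chosen such that the Sobolev and the Hölder
inequality produce the same integral, with a total exponent less than one on the right. -/
theorem exists_lintegral_one_add_sq_rpow_le {n : ℕ} {p q : ℝ} (hp : 1 < p) (hpn : p < n)
    (hq1 : 1 < q) (hq : q < n / p) (M : ℝ≥0) :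
    ∃ C : ℝ≥0, ∀ Ω : Set (EuclideanSpace ℝ (Fin n)), volume Ω ≤ (M : ℝ≥0∞) →
      ∀ f u : EuclideanSpace ℝ (Fin n) → ℝ, MemLp f (ENNReal.ofReal q) (volume.restrict Ω) →
      IsWeakSolution p Ω f u → eLpNorm f (ENNReal.ofReal q) (volume.restrict Ω) ≤ 1 →
      ∫⁻ x in Ω, ENNReal.ofReal ((1 + u x ^ 2) ^ ((p - 1) * q * n / (n - p * q) / 2)) ≤ C := by
  have hp0 : 0 < p := by linarith
  have hp1 : 0 < p - 1 := by linarith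
  have hn0 : (0 : ℝ) < n := hp0.trans hpn
  have hnp : (0 : ℝ) < n - p := by linarith
  have hpq : 0 < (n : ℝ) - p * q := by rw [lt_div_iff₀ hp0] at hq; linarith
  have hq0 : 0 < q := by linarith
  have hqm : 0 < q - 1 := by linarith
  obtain ⟨S, hS⟩ := exists_eLpNorm_comp_rpow_le hp hpn
  set s : ℝ := (p - 1) * q * n / (n - p * q) with hs
  set P : ℝ := n * p / (n - p) with hP
  set q' : ℝ := q.conjExponent with hq'
  have hqq : q.HolderConjugate q' := Real.HolderConjugate.conjExponent hq1
  have hq'e : q' = q / (q - 1) := rfl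
  have hq'0 : 0 < q' := hqq.symm.pos
  -- `δ + 1` is the power in `Φ`, and `p * δ + 1` the power in `F`
  set δ : ℝ := (p - 1) * q * (n - p) / (p * (n - p * q)) - 1 with hδ
  have hδ1 : δ + 1 = (p - 1) * q * (n - p) / (p * (n - p * q)) := by rw [hδ]; ring
  have hδ0 : 0 < δ + 1 := by rw [hδ1]; positivity
  have hγ1 : p * δ + 1 = (p - 1) * n * (q - 1) / (n - p * q) := by
    rw [hδ]; field_simp; ring
  have hγ0 : 0 < p * δ + 1 := by rw [hγ1]; positivity
  have hP0 : 0 < P := by positivity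
  have hP1 : 1 ≤ P := by rw [hP, le_div_iff₀ hnp]; nlinarith
  have hsΦ : (δ + 1) * P = s := by rw [hδ1, hP, hs]; field_simp
  have hsF : (p * δ + 1) * q' = s := by rw [hγ1, hq'e, hs]; field_simp
  set θ : ℝ := 1 / q' * (P / p) with hθ
  have hθ0 : 0 ≤ θ := by positivity
  have hθ1 : θ < 1 := by
    have : θ = (q - 1) * n / (q * (n - p)) := by rw [hθ, hq'e, hP]; field_simp
    rw [this, div_lt_one (by positivity)]
    linarith
  set K : ℝ := max 1 (1 + δ) ^ p / min 1 (1 + p * δ) with hK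
  have hK0 : 0 ≤ K := div_nonneg (by positivity) (le_min zero_le_one (by linarith))
  set a : ℝ≥0∞ := ENNReal.ofReal (2 ^ ((δ + 1) / 2)) with ha
  set D : ℝ≥0∞ := 2 ^ (P - 1) * (a ^ P * M + 2 ^ P * ((S : ℝ≥0∞) ^ p * ENNReal.ofReal K) ^ (P / p))
    with hD
  have hDt : D ≠ ⊤ := by
    have h1 : (2 : ℝ≥0∞) ^ (P - 1) ≠ ⊤ := ENNReal.rpow_ne_top_of_nonneg (by linarith) (by simp)
    have h2 : a ^ P ≠ ⊤ := ENNReal.rpow_ne_top_of_nonneg hP0.le (by simp [ha])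
    have h3 : (2 : ℝ≥0∞) ^ P ≠ ⊤ := ENNReal.rpow_ne_top_of_nonneg hP0.le (by simp)
    have h4 : ((S : ℝ≥0∞) ^ p * ENNReal.ofReal K) ^ (P / p) ≠ ⊤ :=
      ENNReal.rpow_ne_top_of_nonneg (by positivity)
        (ENNReal.mul_ne_top (ENNReal.rpow_ne_top_of_nonneg hp0.le (by simp)) (by simp))
    exact ENNReal.mul_ne_top h1 (ENNReal.add_ne_top.2
      ⟨ENNReal.mul_ne_top h2 (by simp), ENNReal.mul_ne_top h3 h4⟩)
  have hCt : max 1 ((D * 2) ^ (1 / (1 - θ))) ≠ ⊤ := by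
    refine (max_lt (by simp) (lt_top_iff_ne_top.2 ?_)).ne
    refine ENNReal.rpow_ne_top_of_nonneg ?_ (ENNReal.mul_ne_top hDt (by simp))
    have : 0 < 1 - θ := by linarith
    positivity
  refine ⟨(max 1 ((D * 2) ^ (1 / (1 - θ)))).toNNReal, ?_⟩
  rw [ENNReal.coe_toNNReal hCt]
  intro Ω hΩ f u hf hu hf1
  have hum : AEStronglyMeasurable u (volume.restrict Ω) := by
    obtain ⟨G, hu, -⟩ := hu
    exact hu.isW1p.memLp.1
  have hΩt : volume Ω < ⊤ := hΩ.trans_lt (by simp)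
  have hwm : ∀ ε, AEStronglyMeasurable
      (fun x => (1 + smoothTrunc ε (u x) ^ 2) ^ (s / 2)) (volume.restrict Ω) := by
    intro ε
    have : Continuous fun t => (1 + smoothTrunc ε t ^ 2) ^ (s / 2) :=
      (continuous_const.add ((contDiff_smoothTrunc ε).continuous.pow 2)).rpow_const
        fun t => Or.inl (ne_of_gt (by positivity : 0 < 1 + smoothTrunc ε t ^ 2))
    exact this.comp_aestronglyMeasurable hum
  have key : ∀ ε : ℝ, 0 < ε → ∫⁻ x in Ω, ENNReal.ofReal
      ((1 + smoothTrunc ε (u x) ^ 2) ^ (s / 2)) ≤ max 1 ((D * 2) ^ (1 / (1 - θ))) := by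
    intro ε hε
    set W := ∫⁻ x in Ω, ENNReal.ofReal ((1 + smoothTrunc ε (u x) ^ 2) ^ (s / 2)) with hW
    have hWt : W ≠ ⊤ := by
      have hc : Continuous fun t : ℝ => (1 + t ^ 2) ^ (s / 2) :=
        (continuous_const.add (continuous_id.pow 2)).rpow_const fun t =>
          Or.inl (ne_of_gt (by positivity : 0 < 1 + t ^ 2))
      obtain ⟨A, hA⟩ := exists_abs_comp_smoothTrunc_le hε hc
      refine ((lintegral_mono (g := fun _ => ENNReal.ofReal A) fun x =>
        ENNReal.ofReal_le_ofReal ((le_abs_self _).trans (hA (u x)))).trans_lt ?_).ne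
      rw [setLIntegral_const]
      exact ENNReal.mul_lt_top (by simp) hΩt
    refine le_of_le_mul_one_add_rpow hWt hθ0 hθ1 ?_
    have hFs : ∀ γ, ContDiff ℝ ∞ (fun t => smoothPower γ (smoothTrunc ε t)) := fun γ =>
      (contDiff_smoothPower γ).comp (contDiff_smoothTrunc ε)
    obtain ⟨A, hA⟩ := exists_abs_comp_smoothTrunc_le hε
      (contDiff_smoothPower (p * δ)).continuous
    obtain ⟨B, hB⟩ := exists_abs_deriv_smoothPower_comp_smoothTrunc_le (p * δ) hε
    obtain ⟨B', hB'⟩ := exists_abs_deriv_smoothPower_comp_smoothTrunc_le δ hε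
    have hmain := hS Ω hΩt f u q q' hqq hf hu (fun t => smoothPower (p * δ) (smoothTrunc ε t))
      (fun t => smoothPower δ (smoothTrunc ε t)) A B B' K (hFs _) (hFs _) (by simp) (by simp)
      hA hB hB' hK0 (abs_deriv_rpow_le hp.le (by linarith) (by linarith) hε)
    set X := eLpNorm (fun x => smoothPower δ (smoothTrunc ε (u x))) (ENNReal.ofReal P)
      (volume.restrict Ω) with hX
    have hFW : eLpNorm (fun x => smoothPower (p * δ) (smoothTrunc ε (u x))) (ENNReal.ofReal q')
        (volume.restrict Ω) ≤ W ^ (1 / q') := by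
      rw [eLpNorm_eq_lintegral_rpow_enorm_toReal (by simpa using hq'0) (by simp),
        ENNReal.toReal_ofReal hq'0.le]
      refine ENNReal.rpow_le_rpow (lintegral_mono fun x => ?_) (by positivity)
      rw [← ofReal_norm, ENNReal.ofReal_rpow_of_nonneg (norm_nonneg _) hq'0.le]
      refine ENNReal.ofReal_le_ofReal ?_
      refine (Real.rpow_le_rpow (norm_nonneg _) (abs_smoothPower_le _ _) hq'0.le).trans_eq ?_
      rw [← Real.rpow_mul (by positivity), ← hsF]
      congr 1; ring
    have hXP : X ^ P = ∫⁻ x in Ω, ‖smoothPower δ (smoothTrunc ε (u x))‖ₑ ^ P := by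
      rw [hX, eLpNorm_eq_lintegral_rpow_enorm_toReal (by simpa using hP0) (by simp),
        ENNReal.toReal_ofReal hP0.le, ← ENNReal.rpow_mul, one_div_mul_cancel hP0.ne',
        ENNReal.rpow_one]
    have hXW : X ^ P ≤ ((S : ℝ≥0∞) ^ p * ENNReal.ofReal K) ^ (P / p) * W ^ θ := by
      have h1 : X ^ p ≤ (S : ℝ≥0∞) ^ p * ENNReal.ofReal K * W ^ (1 / q') := by
        refine hmain.trans ?_
        rw [mul_assoc]
        gcongr
        calc _ ≤ 1 * W ^ (1 / q') := by gcongr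
          _ = _ := one_mul _
      have h2 := ENNReal.rpow_le_rpow h1 (by positivity : 0 ≤ P / p)
      rwa [← ENNReal.rpow_mul, mul_div_cancel₀ _ hp0.ne',
        ENNReal.mul_rpow_of_nonneg _ _ (by positivity), ← ENNReal.rpow_mul] at h2
    have hWX : W ≤ 2 ^ (P - 1) * (a ^ P * M + 2 ^ P * X ^ P) := by
      have hpt : ∀ x, ENNReal.ofReal ((1 + smoothTrunc ε (u x) ^ 2) ^ (s / 2)) ≤
          2 ^ (P - 1) * (a ^ P + 2 ^ P * ‖smoothPower δ (smoothTrunc ε (u x))‖ₑ ^ P) := by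
        intro x
        have h1 := one_add_sq_rpow_le (by linarith : -1 ≤ δ) (smoothTrunc ε (u x))
        have h2 : (1 + smoothTrunc ε (u x) ^ 2) ^ (s / 2) =
            ((1 + smoothTrunc ε (u x) ^ 2) ^ ((δ + 1) / 2)) ^ P := by
          rw [← Real.rpow_mul (by positivity), ← hsΦ]
          congr 1; ring
        rw [h2, ← ENNReal.ofReal_rpow_of_nonneg (by positivity) hP0.le,
          ← ENNReal.mul_rpow_of_nonneg _ _ hP0.le]
        refine le_trans ?_ (ENNReal.rpow_add_le_mul_rpow_add_rpow _ _ hP1)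
        refine ENNReal.rpow_le_rpow ?_ hP0.le
        refine (ENNReal.ofReal_le_ofReal h1).trans_eq ?_
        rw [ENNReal.ofReal_add (by positivity) (by positivity), ENNReal.ofReal_mul (by norm_num),
          ← Real.norm_eq_abs, ofReal_norm]
        simp [ha]
      refine (lintegral_mono hpt).trans ?_
      rw [lintegral_const_mul' _ _ (ENNReal.rpow_ne_top_of_nonneg (by linarith) (by simp)),
        lintegral_add_left measurable_const, setLIntegral_const,
        lintegral_const_mul' _ _ (ENNReal.rpow_ne_top_of_nonneg hP0.le (by simp)), ← hXP]
      gcongr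
    calc W ≤ 2 ^ (P - 1) * (a ^ P * M + 2 ^ P * X ^ P) := hWX
      _ ≤ 2 ^ (P - 1) * (a ^ P * M * (1 + W ^ θ) + 2 ^ P *
          (((S : ℝ≥0∞) ^ p * ENNReal.ofReal K) ^ (P / p) * (1 + W ^ θ))) := by
        refine mul_le_mul_right (add_le_add ?_ (mul_le_mul_right ?_ _)) _
        · exact le_mul_of_one_le_right zero_le le_self_add
        · exact hXW.trans (mul_le_mul_right le_add_self _)
      _ = D * (1 + W ^ θ) := by rw [hD]; ring
  -- let the truncation height tend to infinity
  have hfat := lintegral_liminf_le' (u := atTop) (μ := volume.restrict Ω)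
    (f := fun (k : ℕ) x => ENNReal.ofReal
      ((1 + smoothTrunc (1 / ((k : ℝ) + 1)) (u x) ^ 2) ^ (s / 2)))
    (fun k => (hwm _).aemeasurable.ennreal_ofReal)
  have hpt : ∀ x, liminf (fun k : ℕ => ENNReal.ofReal
      ((1 + smoothTrunc (1 / ((k : ℝ) + 1)) (u x) ^ 2) ^ (s / 2))) atTop =
      ENNReal.ofReal ((1 + u x ^ 2) ^ (s / 2)) := by
    intro x
    refine Tendsto.liminf_eq (ENNReal.tendsto_ofReal ?_)
    exact (((tendsto_smoothTrunc (u x)).pow 2).const_add 1).rpow_const (Or.inl (by positivity))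
  simp_rw [hpt] at hfat
  refine hfat.trans ?_
  refine (liminf_le_liminf (.of_forall fun k => key _ (by positivity))).trans_eq ?_
  simp

/-- The a priori estimate, including the critical exponent. -/
theorem lebesgueEstimate_of_le {n : ℕ} {p q r : ℝ} (hp : 1 < p) (hpn : p < n)
    (hq1 : 1 < q) (hq : q < n / p) (hr : 0 < r) (hrs : r ≤ (p - 1) * q * n / (n - p * q)) :
    LebesgueEstimate n p q r := by
  intro M
  obtain ⟨C, hC⟩ := exists_lintegral_one_add_sq_rpow_le hp hpn hq1 hq M
  refine ⟨C ^ (1 / r), ?_⟩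
  intro Ω _ hΩ f u hf hu
  have hmain := eLpNorm_le_of_unit_data (r := r) (C := C ^ (1 / r)) hp (fun f u hf hu hf1 => by
    rw [eLpNorm_eq_lintegral_rpow_enorm_toReal (by simpa using hr) (by simp),
      ENNReal.toReal_ofReal hr.le, ENNReal.coe_rpow_of_nonneg _ (by positivity)]
    refine ENNReal.rpow_le_rpow (le_trans (lintegral_mono fun x => ?_) (hC Ω hΩ f u hf hu hf1))
      (by positivity)
    rw [← ofReal_norm, ENNReal.ofReal_rpow_of_nonneg (norm_nonneg _) hr.le]
    refine ENNReal.ofReal_le_ofReal ?_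
    calc ‖u x‖ ^ r ≤ √(1 + u x ^ 2) ^ r := by
          gcongr
          exact Real.abs_le_sqrt (by linarith)
      _ = (1 + u x ^ 2) ^ (r / 2) := by
          rw [Real.sqrt_eq_rpow, ← Real.rpow_mul (by positivity)]; congr 1; ring
      _ ≤ _ := by
          gcongr
          nlinarith [sq_nonneg (u x)]) hf hu
  refine ⟨⟨?_, hmain.trans_lt ?_⟩, hmain⟩
  · obtain ⟨G, hu, -⟩ := hu
    exact hu.isW1p.memLp.1
  · refine ENNReal.mul_lt_top (by simp) (lt_top_iff_ne_top.2 ?_)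
    exact ENNReal.rpow_ne_top_of_nonneg (by
      have : 0 < p - 1 := by linarith
      positivity) hf.2.ne

/-- On sets of bounded measure the `L^q` norms grow with `q` up to a constant, so an estimate for
the exponent `q` implies the one for a larger exponent. -/
theorem LebesgueEstimate.mono {n : ℕ} {p q₁ q₂ r : ℝ} (hp : 1 < p) (hq₁ : 0 < q₁) (hq : q₁ ≤ q₂)
    (h : LebesgueEstimate n p q₁ r) : LebesgueEstimate n p q₂ r := by
  intro M
  obtain ⟨C, hC⟩ := h M
  have he : 0 ≤ 1 / q₁ - 1 / q₂ := sub_nonneg.2 (one_div_le_one_div_of_le hq₁ hq)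
  have hp1 : 0 < p - 1 := by linarith
  refine ⟨C * (M ^ (1 / q₁ - 1 / q₂)) ^ (1 / (p - 1)), ?_⟩
  intro Ω hΩ hΩM f u hf hu
  have hfin : IsFiniteMeasure (volume.restrict Ω) := ⟨by simpa using hΩM.trans_lt (by simp)⟩
  obtain ⟨h1, h2⟩ := hC Ω hΩ hΩM f u
    (hf.mono_exponent (ENNReal.ofReal_le_ofReal hq)) hu
  refine ⟨h1, h2.trans ?_⟩
  rw [ENNReal.coe_mul, mul_assoc, ENNReal.coe_rpow_of_nonneg _ (by positivity),
    ← ENNReal.mul_rpow_of_nonneg _ _ (by positivity), ENNReal.coe_rpow_of_nonneg _ he]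
  gcongr
  refine (eLpNorm_le_eLpNorm_mul_rpow_measure_univ (ENNReal.ofReal_le_ofReal hq) hf.1).trans ?_
  rw [mul_comm, ENNReal.toReal_ofReal hq₁.le, ENNReal.toReal_ofReal (hq₁.le.trans hq)]
  gcongr
  simpa using hΩM

/-- The edge case `q = n / p`, reduced to exponents slightly below `n / p`. -/
theorem lebesgueEstimate_edge {n : ℕ} {p r : ℝ} (hp : 1 < p) (hpn : p < n) (hr : 0 < r) :
    LebesgueEstimate n p (n / p) r := by
  have hp0 : 0 < p := by linarith
  have hn0 : (0 : ℝ) < n := hp0.trans hpn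
  have h1 : 1 < n / p := (one_lt_div hp0).2 hpn
  -- the critical exponent is at least `r` as soon as `(p-1)n/(n-pq) ≥ r`
  set q := max ((1 + n / p) / 2) ((n - (p - 1) * n / r) / p) with hq
  have hq1 : 1 < q := lt_max_of_lt_left (by linarith)
  have hqn : q < n / p := by
    refine max_lt (by linarith) ?_
    have : 0 < (p - 1) * n / r := div_pos (mul_pos (by linarith) hn0) hr
    gcongr
    linarith
  refine (lebesgueEstimate_of_le hp hpn hq1 hqn hr ?_).mono hp (by linarith) hqn.le
  have h2 : (n - (p - 1) * n / r) / p ≤ q := le_max_right _ _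
  have hpq : 0 < (n : ℝ) - p * q := by rw [lt_div_iff₀ hp0] at hqn; linarith
  rw [le_div_iff₀ hpq]
  rw [div_le_iff₀ hp0] at h2
  have h3 : n - p * q ≤ (p - 1) * n / r := by linarith
  rw [le_div_iff₀ hr] at h3
  have h4 : (p - 1) * n * 1 ≤ (p - 1) * n * q :=
    mul_le_mul_of_nonneg_left hq1.le (mul_nonneg (by linarith) hn0.le)
  linarith

/-! ### Integrability of power singularities -/

/-- Integration in polar coordinates. -/
theorem integrableOn_ball_norm_sub_rpow_iff {n : ℕ} (hn : 0 < n) (x₀ : EuclideanSpace ℝ (Fin n))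
    {ρ : ℝ} (hρ : 0 < ρ) (β : ℝ) :
    IntegrableOn (fun x => ‖x - x₀‖ ^ (-β)) (Metric.ball x₀ ρ) ↔ β < n := by
  have : Nontrivial (EuclideanSpace ℝ (Fin n)) :=
    Module.nontrivial_of_finrank_pos (R := ℝ) (by simpa using hn)
  have h1 := (measurePreserving_sub_right (volume : Measure (EuclideanSpace ℝ (Fin n)))
    x₀).integrableOn_comp_preimage (MeasurableEquiv.subRight x₀).measurableEmbedding
    (f := fun y => ‖y‖ ^ (-β)) (s := Metric.ball 0 ρ)
  have h2 : (fun x => x - x₀) ⁻¹' Metric.ball (0 : EuclideanSpace ℝ (Fin n)) ρ =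
      Metric.ball x₀ ρ := by
    ext x; simp [dist_eq_norm]
  rw [h2] at h1
  refine h1.trans ?_
  rw [integrableOn_fun_norm_addHaar volume (f := fun t => t ^ (-β)),
    finrank_euclideanSpace, Fintype.card_fin]
  have h3 : Set.EqOn (fun y : ℝ => y ^ (n - 1) • y ^ (-β)) (fun y : ℝ => y ^ ((n : ℝ) - 1 - β))
      (Set.Ioo 0 ρ) := by
    intro y hy
    simp only [smul_eq_mul]
    rw [← Real.rpow_natCast, ← Real.rpow_add hy.1, Nat.cast_sub hn]
    congr 1
    simp; ring
  rw [integrableOn_congr_fun h3 measurableSet_Ioo, intervalIntegral.integrableOn_Ioo_rpow_iff hρ]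
  constructor <;> intro h <;> linarith

/-- A power singularity of subcritical order is in `L^q` of every bounded set. -/
theorem memLp_norm_sub_rpow {n : ℕ} (hn : 0 < n) {Ω : Set (EuclideanSpace ℝ (Fin n))}
    (hΩ : Bornology.IsBounded Ω) (x₀ : EuclideanSpace ℝ (Fin n)) {q ν : ℝ} (hq : 0 < q)
    (hν : ν * q < n) :
    MemLp (fun x => ‖x - x₀‖ ^ (-ν)) (ENNReal.ofReal q) (volume.restrict Ω) := by
  obtain ⟨ρ, hρ⟩ := hΩ.subset_ball x₀
  have hsub : Ω ⊆ Metric.ball x₀ (max ρ 1) :=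
    hρ.trans (Metric.ball_subset_ball (le_max_left _ _))
  have hm : Measurable fun x : EuclideanSpace ℝ (Fin n) => ‖x - x₀‖ ^ (-ν) := by fun_prop
  rw [← integrable_norm_rpow_iff hm.aestronglyMeasurable (by simpa using hq) (by simp),
    ENNReal.toReal_ofReal hq.le]
  have h := ((integrableOn_ball_norm_sub_rpow_iff hn x₀ (ρ := max ρ 1) (by positivity)
    (ν * q)).2 hν).mono_set hsub
  refine h.congr (.of_forall fun x => ?_)
  change ‖x - x₀‖ ^ (-(ν * q)) = ‖‖x - x₀‖ ^ (-ν)‖ ^ q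
  rw [Real.norm_of_nonneg (by positivity), ← Real.rpow_mul (norm_nonneg _)]
  congr 1; ring

/-- A function with a power singularity of supercritical order is not in `L^r`. -/
theorem not_memLp_of_le_norm_sub_rpow {n : ℕ} (hn : 0 < n) {Ω : Set (EuclideanSpace ℝ (Fin n))}
    {x₀ : EuclideanSpace ℝ (Fin n)} {r ν ρ c : ℝ} (hr : 0 < r) (hν : n ≤ ν * r) (hρ : 0 < ρ)
    (hc : 0 < c) (hsub : Metric.ball x₀ ρ ⊆ Ω) {u : EuclideanSpace ℝ (Fin n) → ℝ}
    (hu : ∀ x ∈ Metric.ball x₀ ρ, x ≠ x₀ → c * ‖x - x₀‖ ^ (-ν) ≤ u x) :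
    ¬ MemLp u (ENNReal.ofReal r) (volume.restrict Ω) := by
  have : Nontrivial (EuclideanSpace ℝ (Fin n)) :=
    Module.nontrivial_of_finrank_pos (R := ℝ) (by simpa using hn)
  intro h
  have h1 := (h.mono_measure (Measure.restrict_mono hsub le_rfl)).integrable_norm_rpow
    (by simpa using hr) (by simp)
  rw [ENNReal.toReal_ofReal hr.le] at h1
  refine absurd ((integrableOn_ball_norm_sub_rpow_iff hn x₀ hρ (ν * r)).1 ?_) (not_lt.2 hν)
  refine (h1.const_mul ((c⁻¹) ^ r)).mono'
    (by fun_prop : Measurable fun x => ‖x - x₀‖ ^ (-(ν * r))).aestronglyMeasurable ?_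
  filter_upwards [ae_restrict_mem measurableSet_ball,
    ae_restrict_of_ae (Measure.ae_ne volume x₀)] with x hx hx0
  have h2 := hu x hx hx0
  have h3 : ‖x - x₀‖ ^ (-ν) ≤ c⁻¹ * ‖u x‖ := by
    rw [inv_mul_eq_div, le_div_iff₀ hc, mul_comm]
    exact h2.trans (Real.le_norm_self _)
  rw [Real.norm_of_nonneg (by positivity), ← Real.mul_rpow (by positivity) (norm_nonneg _)]
  calc ‖x - x₀‖ ^ (-(ν * r)) = (‖x - x₀‖ ^ (-ν)) ^ r := by
        rw [← Real.rpow_mul (norm_nonneg _)]; congr 1; ring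
    _ ≤ _ := by gcongr

/-! ### Radial profiles with compact support -/

/-- The profile `s ↦ e^{-c/(R²-s)} s^{-ν/2}` for `s < R²`, cut off smoothly to zero at `R²`. In the
variable `s = |x|²` it has a singularity of order `|x|^{-ν}`. -/
noncomputable def cutPow (c R ν s : ℝ) : ℝ := expNegInvGlue ((R ^ 2 - s) / c) * s ^ (-ν / 2)

theorem expNegInvGlue_le_one (t : ℝ) : expNegInvGlue t ≤ 1 := by
  unfold expNegInvGlue
  split_ifs with h
  · exact zero_le_one
  · exact Real.exp_le_one_iff.2 (by simpa using (not_le.1 h).le)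

/-- Positive powers of the cutoff are smooth: they only rescale its argument. -/
theorem expNegInvGlue_rpow {m : ℝ} (hm : 0 < m) (t : ℝ) :
    expNegInvGlue t ^ m = expNegInvGlue (t / m) := by
  rcases le_or_gt t 0 with h | h
  · rw [expNegInvGlue.zero_of_nonpos h, expNegInvGlue.zero_of_nonpos (by
      exact div_nonpos_of_nonpos_of_nonneg h hm.le), Real.zero_rpow hm.ne']
  · rw [expNegInvGlue, expNegInvGlue, if_neg (not_le.2 h), if_neg (not_le.2 (by positivity)),
      ← Real.exp_mul]
    congr 1
    field_simp

theorem contDiffOn_cutPow (c R ν : ℝ) : ContDiffOn ℝ ∞ (cutPow c R ν) (Set.Ioi 0) := by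
  have h1 : ContDiff ℝ ∞ fun s : ℝ => expNegInvGlue ((R ^ 2 - s) / c) :=
    expNegInvGlue.contDiff.comp ((contDiff_const.sub contDiff_id).div_const c)
  exact h1.contDiffOn.mul fun s hs =>
    (contDiffAt_id.rpow_const_of_ne (ne_of_gt hs)).contDiffWithinAt

theorem continuousOn_deriv_cutPow (c R ν : ℝ) :
    ContinuousOn (deriv (cutPow c R ν)) (Set.Ioi 0) :=
  (contDiffOn_cutPow c R ν).continuousOn_deriv_of_isOpen isOpen_Ioi (by simp)

theorem measurable_cutPow (c R ν : ℝ) : Measurable (cutPow c R ν) := by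
  unfold cutPow
  have : Continuous expNegInvGlue := (expNegInvGlue.contDiff (n := 0)).continuous
  exact (this.measurable.comp (by fun_prop)).mul (by fun_prop)

theorem cutPow_nonneg (c R ν : ℝ) {s : ℝ} (hs : 0 ≤ s) : 0 ≤ cutPow c R ν s :=
  mul_nonneg (expNegInvGlue.nonneg _) (by positivity)

theorem cutPow_le (c R ν : ℝ) {s : ℝ} (hs : 0 ≤ s) : cutPow c R ν s ≤ s ^ (-ν / 2) :=
  mul_le_of_le_one_left (by positivity) (expNegInvGlue_le_one _)

theorem cutPow_eq_zero {c R : ℝ} (hc : 0 < c) (ν : ℝ) {s : ℝ} (hs : R ^ 2 ≤ s) :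
    cutPow c R ν s = 0 := by
  rw [cutPow, expNegInvGlue.zero_of_nonpos, zero_mul]
  exact div_nonpos_of_nonpos_of_nonneg (by linarith) hc.le

/-- Differentiating the profile raises the order of the singularity by one power of `s`. Beyond `R²`
the profile vanishes, so the derivative of the cutoff contributes a bounded factor only. -/
theorem exists_abs_deriv_cutPow_le {c : ℝ} (hc : 0 < c) (R ν : ℝ) :
    ∃ A : ℝ, 0 ≤ A ∧ ∀ s, 0 < s → |deriv (cutPow c R ν) s| * s ≤ A * s ^ (-ν / 2) := by
  have hg : ContDiff ℝ 1 expNegInvGlue := expNegInvGlue.contDiff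
  obtain ⟨B, hB⟩ := (isCompact_Icc (a := 0) (b := R ^ 2 / c)).exists_bound_of_continuousOn
    (hg.continuous_deriv le_rfl).continuousOn
  have hR : (0 : ℝ) ≤ R ^ 2 / c := by positivity
  have hB0 : 0 ≤ B := (norm_nonneg _).trans (hB 0 ⟨le_rfl, hR⟩)
  refine ⟨B / c * R ^ 2 + |ν / 2|, by positivity, fun s hs => ?_⟩
  rcases lt_or_ge (R ^ 2) s with h | h
  · have : cutPow c R ν =ᶠ[𝓝 s] fun _ => 0 := by
      filter_upwards [lt_mem_nhds h] with t ht using cutPow_eq_zero hc ν ht.le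
    rw [this.deriv_eq]
    simp only [deriv_const, abs_zero, zero_mul]
    positivity
  · have h1 : HasDerivAt (fun t => expNegInvGlue ((R ^ 2 - t) / c))
        (deriv expNegInvGlue ((R ^ 2 - s) / c) * (-1 / c)) s := by
      have h2 : HasDerivAt (fun t => (R ^ 2 - t) / c) (-1 / c) s :=
        ((hasDerivAt_id s).const_sub (R ^ 2)).div_const c
      exact ((hg.differentiable one_ne_zero _).hasDerivAt).comp s h2
    have h3 : HasDerivAt (fun t : ℝ => t ^ (-ν / 2)) (-ν / 2 * s ^ (-ν / 2 - 1)) s :=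
      Real.hasDerivAt_rpow_const (Or.inl hs.ne')
    have h4 : deriv (cutPow c R ν) s = _ := (h1.mul h3).deriv
    have h5 : |deriv expNegInvGlue ((R ^ 2 - s) / c)| ≤ B :=
      hB _ ⟨div_nonneg (by linarith) hc.le, by gcongr; linarith⟩
    have h6 : s ^ (-ν / 2 - 1) * s = s ^ (-ν / 2) := by
      rw [Real.rpow_sub_one hs.ne']; field_simp
    have h7 : |expNegInvGlue ((R ^ 2 - s) / c)| ≤ 1 := by
      rw [abs_of_nonneg (expNegInvGlue.nonneg _)]; exact expNegInvGlue_le_one _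
    have hp : 0 < s ^ (-ν / 2) := by positivity
    calc |deriv (cutPow c R ν) s| * s = |deriv (cutPow c R ν) s * s| := by
          rw [abs_mul, abs_of_pos hs]
      _ = |deriv expNegInvGlue ((R ^ 2 - s) / c) * (-1 / c * s) * s ^ (-ν / 2) +
          expNegInvGlue ((R ^ 2 - s) / c) * (-ν / 2) * s ^ (-ν / 2)| := by
          rw [h4, ← h6]
          congr 1; ring
      _ ≤ B * (1 / c * R ^ 2) * s ^ (-ν / 2) + 1 * |ν / 2| * s ^ (-ν / 2) := by
          refine (abs_add_le _ _).trans ?_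
          have h8 : |(-1 / c * s)| ≤ 1 / c * R ^ 2 := by
            rw [neg_div, neg_mul, abs_neg, abs_of_pos (by positivity : 0 < 1 / c * s)]
            gcongr
          have h9 : |-ν / 2| = |ν / 2| := by rw [neg_div, abs_neg]
          simp only [abs_mul _ (s ^ (-ν / 2)), abs_of_pos hp]
          rw [abs_mul _ (-1 / c * s), abs_mul _ (-ν / 2), h9]
          gcongr
      _ = _ := by ring

/-- A primitive of `-κ/2`, for the profile `κ = cutPow 1 R (α + 2)`. -/
noncomputable def cutPrimitive (R α s : ℝ) : ℝ := ∫ t in s..R ^ 2, cutPow 1 R (α + 2) t / 2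

theorem intervalIntegrable_cutPow (c ν : ℝ) {R s t : ℝ} (hs : 0 < s) (ht : 0 < t) :
    IntervalIntegrable (fun t => cutPow c R ν t / 2) volume s t := by
  refine ContinuousOn.intervalIntegrable ?_
  refine ((contDiffOn_cutPow c R ν).continuousOn.div_const 2).mono fun x hx => ?_
  exact (lt_min hs ht).trans_le hx.1

theorem hasDerivAt_cutPrimitive {R : ℝ} (hR : 0 < R) (α : ℝ) {s : ℝ} (hs : 0 < s) :
    HasDerivAt (cutPrimitive R α) (-(cutPow 1 R (α + 2) s / 2)) s := by
  refine intervalIntegral.integral_hasDerivAt_left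
    (intervalIntegrable_cutPow 1 (α + 2) hs (by positivity)) ?_ ?_
  · exact ((measurable_cutPow _ _ _).div_const 2).stronglyMeasurable.stronglyMeasurableAtFilter
  · exact ((contDiffOn_cutPow 1 R (α + 2)).continuousOn.div_const 2).continuousAt
      (Ioi_mem_nhds hs)

theorem contDiffOn_cutPrimitive {R : ℝ} (hR : 0 < R) (α : ℝ) :
    ContDiffOn ℝ ∞ (cutPrimitive R α) (Set.Ioi 0) := by
  rw [contDiffOn_infty_iff_deriv_of_isOpen isOpen_Ioi]
  refine ⟨fun s hs => (hasDerivAt_cutPrimitive hR α hs).differentiableAt.differentiableWithinAt, ?_⟩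
  exact ((contDiffOn_cutPow 1 R (α + 2)).div_const 2).neg.congr fun s hs =>
    (hasDerivAt_cutPrimitive hR α hs).deriv

theorem cutPrimitive_eq_zero {R : ℝ} (α : ℝ) {s : ℝ} (hs : R ^ 2 ≤ s) :
    cutPrimitive R α s = 0 := by
  rw [cutPrimitive, ← intervalIntegral.integral_zero (μ := volume) (a := s) (b := R ^ 2)]
  refine intervalIntegral.integral_congr fun t ht => ?_
  rw [Set.uIcc_of_ge hs] at ht
  simp [cutPow_eq_zero one_pos _ ht.1]

theorem cutPrimitive_nonneg {R : ℝ} (α : ℝ) {s : ℝ} (hs : 0 ≤ s) : 0 ≤ cutPrimitive R α s := by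
  rcases le_total (R ^ 2) s with h | h
  · rw [cutPrimitive_eq_zero α h]
  · exact intervalIntegral.integral_nonneg h fun t ht =>
      div_nonneg (cutPow_nonneg _ _ _ (hs.trans ht.1)) zero_le_two

/-- The primitive is at most of order `s^{-α/2}`, that is, `|x|^{-α}`. -/
theorem cutPrimitive_le {R α : ℝ} (hR : 0 < R) (hα : 0 < α) {s : ℝ} (hs : 0 < s) :
    cutPrimitive R α s ≤ 1 / α * s ^ (-α / 2) := by
  rcases le_total (R ^ 2) s with h | h
  · rw [cutPrimitive_eq_zero α h]; positivity
  · have h0 : (0 : ℝ) ∉ Set.uIcc s (R ^ 2) := by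
      rw [Set.uIcc_of_le h]; exact fun h' => absurd h'.1 (not_le.2 hs)
    have h1 : cutPrimitive R α s ≤ ∫ t in s..R ^ 2, t ^ (-(α + 2) / 2) / 2 := by
      refine intervalIntegral.integral_mono_on h
        (intervalIntegrable_cutPow 1 (α + 2) hs (by positivity))
        ((intervalIntegral.intervalIntegrable_rpow (Or.inr h0)).div_const 2) fun t ht => ?_
      have := cutPow_le 1 R (α + 2) (hs.le.trans ht.1)
      gcongr
    refine h1.trans ?_
    rw [intervalIntegral.integral_div, integral_rpow (Or.inr ⟨by
      intro h; linarith [(div_eq_iff (two_ne_zero (α := ℝ))).1 h], h0⟩)]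
    have h2 : -(α + 2) / 2 + 1 = -α / 2 := by ring
    rw [h2]
    have h3 : 0 < (R ^ 2) ^ (-α / 2) := by positivity
    rw [div_div, ← sub_nonneg]
    have h4 : 1 / α * s ^ (-α / 2) - ((R ^ 2) ^ (-α / 2) - s ^ (-α / 2)) / (-α / 2 * 2) =
      (R ^ 2) ^ (-α / 2) / α := by field_simp; ring
    rw [h4]; positivity

/-- Near the origin the primitive is at least of order `s^{-α/2}`: on `[s, 2s]` the integrand is
comparable to `s^{-α/2-1}`. -/
theorem exists_le_cutPrimitive {R : ℝ} (hR : 0 < R) {α : ℝ} (hα : 0 < α) :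
    ∃ c, 0 < c ∧ ∀ s, 0 < s → s ≤ R ^ 2 / 4 → c * s ^ (-α / 2) ≤ cutPrimitive R α s := by
  have hg : 0 < expNegInvGlue (R ^ 2 / 2) := expNegInvGlue.pos_of_pos (by positivity)
  refine ⟨expNegInvGlue (R ^ 2 / 2) * 2 ^ (-(α + 2) / 2) / 2, by positivity, fun s hs hsR => ?_⟩
  have hR2 : 0 < R ^ 2 := by positivity
  have h1 : cutPrimitive R α s = (∫ t in s..2 * s, cutPow 1 R (α + 2) t / 2) +
      cutPrimitive R α (2 * s) := by
    rw [cutPrimitive, cutPrimitive, intervalIntegral.integral_add_adjacent_intervals]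
    · exact intervalIntegrable_cutPow 1 (α + 2) hs (by positivity)
    · exact intervalIntegrable_cutPow 1 (α + 2) (by positivity) (by positivity)
  have h2 : ∫ _ in s..2 * s, expNegInvGlue (R ^ 2 / 2) * (2 * s) ^ (-(α + 2) / 2) / 2 ≤
      ∫ t in s..2 * s, cutPow 1 R (α + 2) t / 2 := by
    refine intervalIntegral.integral_mono_on (by linarith) (by simp)
      (intervalIntegrable_cutPow 1 (α + 2) hs (by positivity)) fun t ht => ?_
    have ht0 : 0 < t := hs.trans_le ht.1
    have h3 : expNegInvGlue (R ^ 2 / 2) ≤ expNegInvGlue ((R ^ 2 - t) / 1) :=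
      expNegInvGlue.monotone (by linarith [ht.2])
    have h4 : (2 * s) ^ (-(α + 2) / 2) ≤ t ^ (-(α + 2) / 2) :=
      Real.rpow_le_rpow_of_nonpos ht0 ht.2 (by linarith)
    have h5 := mul_le_mul h3 h4 (by positivity) (expNegInvGlue.nonneg _)
    unfold cutPow
    linarith
  rw [h1]
  refine le_trans (le_of_eq ?_) (le_add_of_le_of_nonneg h2 (cutPrimitive_nonneg α (by positivity)))
  rw [intervalIntegral.integral_const, smul_eq_mul, Real.mul_rpow zero_le_two hs.le]
  have h5 : s ^ (-α / 2) = s * s ^ (-(α + 2) / 2) := by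
    have : -α / 2 = -(α + 2) / 2 + 1 := by ring
    rw [this, Real.rpow_add_one hs.ne', mul_comm]
  rw [h5]; ring

/-! ### Radial functions as test functions, and the divergence theorem -/

theorem IsTestFunction.eq_zero_of_notMem {n : ℕ} {Ω : Set (EuclideanSpace ℝ (Fin n))}
    {φ : EuclideanSpace ℝ (Fin n) → ℝ} (hφ : IsTestFunction Ω φ) {x : EuclideanSpace ℝ (Fin n)}
    (hx : x ∉ Ω) : φ x = 0 :=
  image_eq_zero_of_notMem_tsupport fun h => hx (hφ.tsupport_subset h)

theorem IsTestFunction.fderiv_eq_zero_of_notMem {n : ℕ} {Ω : Set (EuclideanSpace ℝ (Fin n))}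
    {φ : EuclideanSpace ℝ (Fin n) → ℝ} (hφ : IsTestFunction Ω φ) {x : EuclideanSpace ℝ (Fin n)}
    (hx : x ∉ Ω) : fderiv ℝ φ x = 0 := by
  by_contra h
  exact hx (hφ.tsupport_subset (support_fderiv_subset ℝ h))

theorem IsTestFunction.gradient_eq_zero_of_notMem {n : ℕ} {Ω : Set (EuclideanSpace ℝ (Fin n))}
    {φ : EuclideanSpace ℝ (Fin n) → ℝ} (hφ : IsTestFunction Ω φ) {x : EuclideanSpace ℝ (Fin n)}
    (hx : x ∉ Ω) : gradient φ x = 0 := by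
  simp [gradient, hφ.fderiv_eq_zero_of_notMem hx]

theorem IsTestFunction.continuous_fderiv_apply {n : ℕ} {Ω : Set (EuclideanSpace ℝ (Fin n))}
    {φ : EuclideanSpace ℝ (Fin n) → ℝ} (hφ : IsTestFunction Ω φ)
    (v : EuclideanSpace ℝ (Fin n)) : Continuous fun x => fderiv ℝ φ x v :=
  (hφ.contDiff.continuous_fderiv (by simp)).clm_apply continuous_const

/-- Integration by parts over the whole space, one factor being a test function. -/
theorem integral_mul_fderiv_eq_neg {n : ℕ} {Ω : Set (EuclideanSpace ℝ (Fin n))}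
    {g φ : EuclideanSpace ℝ (Fin n) → ℝ} (hg : ContDiff ℝ ∞ g) (hφ : IsTestFunction Ω φ)
    (v : EuclideanSpace ℝ (Fin n)) :
    ∫ x, g x * fderiv ℝ φ x v = - ∫ x, fderiv ℝ g x v * φ x := by
  have hg' : Continuous fun x => fderiv ℝ g x v :=
    (hg.continuous_fderiv (by simp)).clm_apply continuous_const
  refine integral_mul_fderiv_eq_neg_fderiv_mul_of_integrable ?_ ?_ ?_
    (fun x _ => hg.differentiable (by simp) x) (fun x _ => hφ.contDiff.differentiable (by simp) x)
  · exact (hg'.mul hφ.contDiff.continuous).integrable_of_hasCompactSupport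
      hφ.hasCompactSupport.mul_left
  · exact (hg.continuous.mul (hφ.continuous_fderiv_apply v)).integrable_of_hasCompactSupport
      ((hφ.hasCompactSupport.fderiv_apply (𝕜 := ℝ) v).mul_left)
  · exact (hg.continuous.mul hφ.contDiff.continuous).integrable_of_hasCompactSupport
      hφ.hasCompactSupport.mul_left

/-- An `L^p` limit of test functions whose gradients converge in `L^p` lies in `W_0^{1,p}`: the
integration by parts formula passes to the limit. -/
theorem IsW1pZeroWithGrad.of_approx {n : ℕ} {p : ℝ} (hp : 1 < p)
    {Ω : Set (EuclideanSpace ℝ (Fin n))} {u : EuclideanSpace ℝ (Fin n) → ℝ}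
    {G : EuclideanSpace ℝ (Fin n) → EuclideanSpace ℝ (Fin n)}
    (hu : MemLp u (ENNReal.ofReal p) (volume.restrict Ω))
    (hG : MemLp G (ENNReal.ofReal p) (volume.restrict Ω))
    {φ : ℕ → EuclideanSpace ℝ (Fin n) → ℝ} (hφ : ∀ k, IsTestFunction Ω (φ k))
    (h1 : Tendsto (fun k => eLpNorm (fun x => u x - φ k x) (ENNReal.ofReal p)
      (volume.restrict Ω)) atTop (𝓝 0))
    (h2 : Tendsto (fun k => eLpNorm (fun x => G x - gradient (φ k) x) (ENNReal.ofReal p)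
      (volume.restrict Ω)) atTop (𝓝 0)) : IsW1pZeroWithGrad p Ω u G := by
  refine ⟨⟨hu, hG, fun ψ hψ v => ?_⟩, φ, hφ, h1, h2⟩
  have : ENNReal.HolderConjugate (ENNReal.ofReal p) (ENNReal.ofReal p.conjExponent) :=
    (Real.HolderConjugate.conjExponent hp).ennrealOfReal
  have hA : MemLp (fun x => fderiv ℝ ψ x v) (ENNReal.ofReal p.conjExponent)
      (volume.restrict Ω) :=
    ((hψ.continuous_fderiv_apply v).memLp_of_hasCompactSupport
      (hψ.hasCompactSupport.fderiv_apply (𝕜 := ℝ) v)).restrict _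
  have hA' : MemLp (fun x => ψ x • v) (ENNReal.ofReal p.conjExponent) (volume.restrict Ω) :=
    ((hψ.contDiff.continuous.smul continuous_const).memLp_of_hasCompactSupport
      hψ.hasCompactSupport.smul_right).restrict _
  have l1 := tendsto_integral_inner_of_tendsto_eLpNorm hA hu
    (fun k => (hφ k).contDiff.continuous.aestronglyMeasurable) h1
  have l2 := (tendsto_integral_inner_of_tendsto_eLpNorm hA' hG
    (fun k => (hφ k).continuous_gradient.aestronglyMeasurable) h2).neg
  have hk : ∀ k, ∫ x in Ω, inner ℝ (fderiv ℝ ψ x v) (φ k x) =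
      - ∫ x in Ω, inner ℝ (ψ x • v) (gradient (φ k) x) := by
    intro k
    rw [setIntegral_eq_integral_of_forall_compl_eq_zero fun x hx => by
        simp [(hφ k).eq_zero_of_notMem hx],
      setIntegral_eq_integral_of_forall_compl_eq_zero fun x hx => by
        simp [hψ.eq_zero_of_notMem hx]]
    refine Eq.trans ?_ ((integral_mul_fderiv_eq_neg (hφ k).contDiff hψ v).trans ?_)
    · rfl
    · congr 2; ext1 x
      rw [real_inner_smul_left, real_inner_comm, inner_gradient_left, mul_comm]
  simp_rw [hk] at l1
  have := tendsto_nhds_unique l1 l2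
  refine Eq.trans ?_ (this.trans ?_)
  · rfl
  · congr 2; ext1 x
    rw [real_inner_smul_left, real_inner_comm]

theorem hasGradientAt_comp_norm_sub_sq {n : ℕ} (x₀ : EuclideanSpace ℝ (Fin n)) {k : ℝ → ℝ}
    {k' e : ℝ} {x : EuclideanSpace ℝ (Fin n)} (hk : HasDerivAt k k' (‖x - x₀‖ ^ 2 + e)) :
    HasGradientAt (fun x => k (‖x - x₀‖ ^ 2 + e)) ((2 * k') • (x - x₀)) x := by
  have h1 : HasFDerivAt (fun x : EuclideanSpace ℝ (Fin n) => ‖x - x₀‖ ^ 2 + e)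
      (2 • innerSL ℝ (x - x₀)) x := by
    simpa using (((hasFDerivAt_id x).sub_const x₀).norm_sq).add_const e
  rw [hasGradientAt_iff_hasFDerivAt]
  refine (hk.comp_hasFDerivAt x h1).congr_fderiv ?_
  ext y
  simp
  ring

theorem contDiff_comp_norm_sub_sq {n : ℕ} (x₀ : EuclideanSpace ℝ (Fin n)) {k : ℝ → ℝ}
    (hk : ContDiffOn ℝ ∞ k (Set.Ioi 0)) {e : ℝ} (he : 0 < e) :
    ContDiff ℝ ∞ fun x => k (‖x - x₀‖ ^ 2 + e) := by
  have h1 : ContDiff ℝ ∞ fun x : EuclideanSpace ℝ (Fin n) => ‖x - x₀‖ ^ 2 + e :=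
    ((contDiff_id.sub contDiff_const).norm_sq ℝ).add contDiff_const
  exact contDiffOn_univ.1 (hk.comp h1.contDiffOn fun x _ => by
    simp only [Set.mem_Ioi]; positivity)

theorem isTestFunction_comp_norm_sub_sq {n : ℕ} {Ω : Set (EuclideanSpace ℝ (Fin n))}
    {x₀ : EuclideanSpace ℝ (Fin n)} {R : ℝ} (hR : 0 ≤ R) (hsub : Metric.closedBall x₀ R ⊆ Ω)
    {k : ℝ → ℝ} (hk : ContDiffOn ℝ ∞ k (Set.Ioi 0)) (hk0 : ∀ s, R ^ 2 ≤ s → k s = 0) {e : ℝ}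
    (he : 0 < e) : IsTestFunction Ω fun x => k (‖x - x₀‖ ^ 2 + e) := by
  have hsupp : Function.support (fun x => k (‖x - x₀‖ ^ 2 + e)) ⊆ Metric.closedBall x₀ R := by
    intro x hx
    rw [Metric.mem_closedBall, dist_eq_norm]
    by_contra! h
    refine hx (hk0 _ ?_)
    have : R ^ 2 ≤ ‖x - x₀‖ ^ 2 := by gcongr
    linarith
  exact ⟨contDiff_comp_norm_sub_sq x₀ hk he,
    HasCompactSupport.of_support_subset_isCompact (isCompact_closedBall x₀ R) hsupp,
    (closure_minimal hsupp Metric.isClosed_closedBall).trans hsub⟩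

/-- The divergence theorem for the vector field `x ↦ x - x₀`, whose divergence is `n`. -/
theorem integral_inner_sub_gradient {n : ℕ} {Ω : Set (EuclideanSpace ℝ (Fin n))}
    (x₀ : EuclideanSpace ℝ (Fin n)) {φ : EuclideanSpace ℝ (Fin n) → ℝ} (hφ : IsTestFunction Ω φ) :
    ∫ x, inner ℝ (x - x₀) (gradient φ x) = -(n * ∫ x, φ x) := by
  have hc : ∀ i, ContDiff ℝ ∞ fun x : EuclideanSpace ℝ (Fin n) => (x - x₀) i := fun i =>
    (EuclideanSpace.proj (𝕜 := ℝ) i).contDiff.comp (contDiff_id.sub contDiff_const)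
  have hpt : ∀ x, inner ℝ (x - x₀) (gradient φ x) =
      ∑ i, (x - x₀) i * fderiv ℝ φ x (EuclideanSpace.single i 1) := by
    intro x
    rw [real_inner_comm, inner_gradient_left]
    conv_lhs => rw [← (EuclideanSpace.basisFun (Fin n) ℝ).sum_repr (x - x₀)]
    simp
  simp_rw [hpt]
  rw [integral_finsetSum]
  · have : ∀ i, ∫ x, (x - x₀) i * fderiv ℝ φ x (EuclideanSpace.single i 1) = - ∫ x, φ x := by
      intro i
      rw [integral_mul_fderiv_eq_neg (hc i) hφ]
      congr 2; ext1 x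
      have h1 : HasFDerivAt (fun x : EuclideanSpace ℝ (Fin n) => (x - x₀) i)
          (EuclideanSpace.proj (𝕜 := ℝ) i : EuclideanSpace ℝ (Fin n) →L[ℝ] ℝ) x :=
        ((EuclideanSpace.proj (𝕜 := ℝ) i : EuclideanSpace ℝ (Fin n) →L[ℝ] ℝ).hasFDerivAt
          (x := x)).sub_const (x₀ i)
      rw [h1.fderiv]
      simp
    rw [Finset.sum_congr rfl fun i _ => this i]
    simp
  · intro i _
    exact ((hc i).continuous.mul (hφ.continuous_fderiv_apply _)).integrable_of_hasCompactSupport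
      ((hφ.hasCompactSupport.fderiv_apply (𝕜 := ℝ) _).mul_left)

/-- The divergence theorem for a smooth radial vector field `b(|x - x₀|² + e) (x - x₀)`. -/
theorem integral_radial_mul_inner_gradient {n : ℕ} {Ω : Set (EuclideanSpace ℝ (Fin n))}
    (x₀ : EuclideanSpace ℝ (Fin n)) {φ : EuclideanSpace ℝ (Fin n) → ℝ} (hφ : IsTestFunction Ω φ)
    {b : ℝ → ℝ} (hb : ContDiffOn ℝ ∞ b (Set.Ioi 0)) {e : ℝ} (he : 0 < e) :
    ∫ x in Ω, b (‖x - x₀‖ ^ 2 + e) * inner ℝ (x - x₀) (gradient φ x) =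
      - ∫ x in Ω, (n * b (‖x - x₀‖ ^ 2 + e) +
        2 * deriv b (‖x - x₀‖ ^ 2 + e) * ‖x - x₀‖ ^ 2) * φ x := by
  have hB := contDiff_comp_norm_sub_sq x₀ hb he
  have hψ : IsTestFunction Ω fun x => b (‖x - x₀‖ ^ 2 + e) * φ x :=
    ⟨hB.mul hφ.contDiff, hφ.hasCompactSupport.mul_left,
      (tsupport_mul_subset_right).trans hφ.tsupport_subset⟩
  have hd : ∀ x, HasDerivAt b (deriv b (‖x - x₀‖ ^ 2 + e)) (‖x - x₀‖ ^ 2 + e) := fun x =>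
    ((hb.differentiableOn (by simp)).differentiableAt
      (Ioi_mem_nhds (by positivity))).hasDerivAt
  have hpt : ∀ x, inner ℝ (x - x₀) (gradient (fun x => b (‖x - x₀‖ ^ 2 + e) * φ x) x) =
      b (‖x - x₀‖ ^ 2 + e) * inner ℝ (x - x₀) (gradient φ x) +
        2 * deriv b (‖x - x₀‖ ^ 2 + e) * ‖x - x₀‖ ^ 2 * φ x := by
    intro x
    have h1 := (hasGradientAt_comp_norm_sub_sq x₀ (hd x)).hasFDerivAt
    have h2 := (hφ.contDiff.differentiable (by simp) x).hasFDerivAt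
    have h3 : fderiv ℝ (fun x => b (‖x - x₀‖ ^ 2 + e) * φ x) x = _ := (h1.mul h2).fderiv
    rw [real_inner_comm, inner_gradient_left, h3, real_inner_comm (gradient φ x),
      inner_gradient_left]
    simp only [add_apply, smul_apply, smul_eq_mul,
      InnerProductSpace.toDual_apply_apply, real_inner_smul_left, real_inner_self_eq_norm_sq]
    ring
  have hdc : Continuous fun x => deriv b (‖x - x₀‖ ^ 2 + e) := by
    refine (hb.continuousOn_deriv_of_isOpen isOpen_Ioi (by simp)).comp_continuous
      (by fun_prop) fun x => ?_
    simp only [Set.mem_Ioi]; positivity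
  have hnc : Continuous fun x : EuclideanSpace ℝ (Fin n) => ‖x - x₀‖ ^ 2 := by fun_prop
  have i1 : Integrable fun x => b (‖x - x₀‖ ^ 2 + e) * inner ℝ (x - x₀) (gradient φ x) := by
    refine (hB.continuous.mul ((continuous_id.sub continuous_const).inner
      hφ.continuous_gradient)).integrable_of_hasCompactSupport
      (hφ.hasCompactSupport.mono' fun x hx => ?_)
    by_contra h
    refine hx ?_
    have : gradient φ x = 0 := by
      have : fderiv ℝ φ x = 0 := by
        by_contra h'
        exact h (support_fderiv_subset ℝ h')
      simp [gradient, this]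
    change b _ * inner ℝ (x - x₀) (gradient φ x) = 0
    rw [this, inner_zero_right, mul_zero]
  have i2 : Integrable fun x => 2 * deriv b (‖x - x₀‖ ^ 2 + e) * ‖x - x₀‖ ^ 2 * φ x :=
    (((continuous_const.mul hdc).mul hnc).mul hφ.contDiff.continuous
      ).integrable_of_hasCompactSupport hφ.hasCompactSupport.mul_left
  have i3 : Integrable fun x => n * (b (‖x - x₀‖ ^ 2 + e) * φ x) :=
    (continuous_const.mul (hB.continuous.mul hφ.contDiff.continuous)
      ).integrable_of_hasCompactSupport hψ.hasCompactSupport.mul_left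
  have hmain := integral_inner_sub_gradient x₀ hψ
  simp_rw [hpt] at hmain
  rw [integral_add i1 i2, ← integral_const_mul] at hmain
  rw [setIntegral_eq_integral_of_forall_compl_eq_zero fun x hx => by
      simp [hφ.gradient_eq_zero_of_notMem hx],
    setIntegral_eq_integral_of_forall_compl_eq_zero fun x hx => by
      simp [hφ.eq_zero_of_notMem hx]]
  have hsum : ∫ x, (n * b (‖x - x₀‖ ^ 2 + e) +
        2 * deriv b (‖x - x₀‖ ^ 2 + e) * ‖x - x₀‖ ^ 2) * φ x =
      (∫ x, n * (b (‖x - x₀‖ ^ 2 + e) * φ x)) +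
        ∫ x, 2 * deriv b (‖x - x₀‖ ^ 2 + e) * ‖x - x₀‖ ^ 2 * φ x := by
    rw [← integral_add i3 i2]
    congr 1; ext1 x; ring
  rw [hsum]
  linarith

/-! ### The singular weak solution -/

theorem sq_rpow_neg_div_two {t : ℝ} (ht : 0 ≤ t) (ν : ℝ) : (t ^ 2) ^ (-ν / 2) = t ^ (-ν) := by
  rw [← Real.rpow_natCast, ← Real.rpow_mul ht]
  congr 1; push_cast; ring

theorem norm_sub_sq_add_rpow_le {n : ℕ} {x x₀ : EuclideanSpace ℝ (Fin n)} (hx : x ≠ x₀) {ν e : ℝ}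
    (hν : 0 ≤ ν) (he : 0 ≤ e) : (‖x - x₀‖ ^ 2 + e) ^ (-ν / 2) ≤ ‖x - x₀‖ ^ (-ν) := by
  have h0 : 0 < ‖x - x₀‖ := norm_pos_iff.2 (sub_ne_zero.2 hx)
  calc (‖x - x₀‖ ^ 2 + e) ^ (-ν / 2) ≤ (‖x - x₀‖ ^ 2) ^ (-ν / 2) :=
        Real.rpow_le_rpow_of_nonpos (by positivity) (by linarith) (by linarith)
    _ = _ := sq_rpow_neg_div_two h0.le ν

theorem cutPow_mul_norm_le {n : ℕ} {x x₀ : EuclideanSpace ℝ (Fin n)} (hx : x ≠ x₀) (c R : ℝ)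
    {ν e : ℝ} (hν : 0 ≤ ν) (he : 0 ≤ e) :
    cutPow c R ν (‖x - x₀‖ ^ 2 + e) * ‖x - x₀‖ ≤ ‖x - x₀‖ ^ (-(ν - 1)) := by
  have h0 : 0 < ‖x - x₀‖ := norm_pos_iff.2 (sub_ne_zero.2 hx)
  have h1 : ‖x - x₀‖ ^ (-(ν - 1)) = ‖x - x₀‖ ^ (-ν) * ‖x - x₀‖ := by
    rw [← Real.rpow_add_one h0.ne']; congr 1; ring
  rw [h1]
  gcongr
  exact (cutPow_le _ _ _ (by positivity)).trans (norm_sub_sq_add_rpow_le hx hν he)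

/-- The divergence of the (regularized) radial field is dominated by `|x - x₀|^{-ν}`, uniformly in
the regularization parameter `e`. -/
theorem abs_radial_divergence_le {n : ℕ} {x x₀ : EuclideanSpace ℝ (Fin n)} (hx : x ≠ x₀)
    {c R ν e A : ℝ} (hν : 0 ≤ ν) (he : 0 ≤ e) (hA0 : 0 ≤ A)
    (hA : ∀ s, 0 < s → |deriv (cutPow c R ν) s| * s ≤ A * s ^ (-ν / 2)) :
    |n * cutPow c R ν (‖x - x₀‖ ^ 2 + e) +
      2 * deriv (cutPow c R ν) (‖x - x₀‖ ^ 2 + e) * ‖x - x₀‖ ^ 2| ≤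
      (n + 2 * A) * ‖x - x₀‖ ^ (-ν) := by
  have h0 : 0 < ‖x - x₀‖ := norm_pos_iff.2 (sub_ne_zero.2 hx)
  have hs : 0 < ‖x - x₀‖ ^ 2 + e := by positivity
  have h1 := norm_sub_sq_add_rpow_le hx hν he
  have h2 := cutPow_nonneg c R ν hs.le
  have h3 := cutPow_le c R ν hs.le
  calc _ ≤ n * cutPow c R ν (‖x - x₀‖ ^ 2 + e) +
        2 * (|deriv (cutPow c R ν) (‖x - x₀‖ ^ 2 + e)| * (‖x - x₀‖ ^ 2 + e)) := by
        refine (abs_add_le _ _).trans ?_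
        rw [abs_mul, abs_mul, abs_mul, abs_of_nonneg h2, abs_of_nonneg (Nat.cast_nonneg n),
          abs_of_pos (by positivity : 0 < ‖x - x₀‖ ^ 2), abs_two, mul_assoc 2]
        gcongr
        linarith
    _ ≤ n * ‖x - x₀‖ ^ (-ν) + 2 * (A * ‖x - x₀‖ ^ (-ν)) := by
        refine add_le_add (mul_le_mul_of_nonneg_left (h3.trans h1) (Nat.cast_nonneg n)) ?_
        have := (hA _ hs).trans (mul_le_mul_of_nonneg_left h1 hA0)
        linarith
    _ = _ := by ring

theorem tendsto_comp_norm_sub_sq_add {n : ℕ} {x x₀ : EuclideanSpace ℝ (Fin n)} (hx : x ≠ x₀)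
    {g : ℝ → ℝ} (hg : ContinuousOn g (Set.Ioi 0)) :
    Tendsto (fun k : ℕ => g (‖x - x₀‖ ^ 2 + 1 / ((k : ℝ) + 1))) atTop (𝓝 (g (‖x - x₀‖ ^ 2))) := by
  have h0 : 0 < ‖x - x₀‖ := norm_pos_iff.2 (sub_ne_zero.2 hx)
  have h1 : Tendsto (fun k : ℕ => ‖x - x₀‖ ^ 2 + 1 / ((k : ℝ) + 1)) atTop (𝓝 (‖x - x₀‖ ^ 2)) := by
    simpa using (tendsto_one_div_add_atTop_nhds_zero_nat (𝕜 := ℝ)).const_add (‖x - x₀‖ ^ 2)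
  exact (hg.continuousAt (Ioi_mem_nhds (by positivity))).tendsto.comp h1

/-- The radial function with singularity `|x - x₀|^{-α}` and compact support is in `W_0^{1,p}` if
`(α + 1) p < n`; replacing `|x - x₀|²` by `|x - x₀|² + e`, `e ↓ 0`, gives the test functions. -/
theorem isW1pZeroWithGrad_cutPrimitive {n : ℕ} (hn : 0 < n) {p α R : ℝ} (hp : 1 < p)
    (hα : 0 < α) (hαp : (α + 1) * p < n) (hR : 0 < R) {Ω : Set (EuclideanSpace ℝ (Fin n))}
    (hΩ : Bornology.IsBounded Ω) {x₀ : EuclideanSpace ℝ (Fin n)}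
    (hsub : Metric.closedBall x₀ R ⊆ Ω) :
    IsW1pZeroWithGrad p Ω (fun x => cutPrimitive R α (‖x - x₀‖ ^ 2))
      (fun x => -(cutPow 1 R (α + 2) (‖x - x₀‖ ^ 2)) • (x - x₀)) := by
  have : Nontrivial (EuclideanSpace ℝ (Fin n)) :=
    Module.nontrivial_of_finrank_pos (R := ℝ) (by simpa using hn)
  have hp0 : 0 < p := by linarith
  have hae : ∀ᵐ x ∂(volume.restrict Ω), x ≠ x₀ := ae_restrict_of_ae (Measure.ae_ne volume x₀)
  have hφ : ∀ k : ℕ, IsTestFunction Ω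
      (fun x => cutPrimitive R α (‖x - x₀‖ ^ 2 + 1 / ((k : ℝ) + 1))) := fun k =>
    isTestFunction_comp_norm_sub_sq hR.le hsub (contDiffOn_cutPrimitive hR α)
      (fun s hs => cutPrimitive_eq_zero α hs) (by positivity)
  have hgrad : ∀ (k : ℕ) x,
      gradient (fun x => cutPrimitive R α (‖x - x₀‖ ^ 2 + 1 / ((k : ℝ) + 1))) x =
        -(cutPow 1 R (α + 2) (‖x - x₀‖ ^ 2 + 1 / ((k : ℝ) + 1))) • (x - x₀) := by
    intro k x
    rw [(hasGradientAt_comp_norm_sub_sq x₀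
      (hasDerivAt_cutPrimitive hR α (by positivity))).gradient]
    congr 1; ring
  have hlim : ∀ᵐ x ∂(volume.restrict Ω), Tendsto
      (fun k : ℕ => cutPrimitive R α (‖x - x₀‖ ^ 2 + 1 / ((k : ℝ) + 1))) atTop
      (𝓝 (cutPrimitive R α (‖x - x₀‖ ^ 2))) := by
    filter_upwards [hae] with x hx
    exact tendsto_comp_norm_sub_sq_add hx (contDiffOn_cutPrimitive hR α).continuousOn
  have hum : AEStronglyMeasurable (fun x => cutPrimitive R α (‖x - x₀‖ ^ 2))
      (volume.restrict Ω) :=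
    aestronglyMeasurable_of_tendsto_ae atTop
      (fun k => (hφ k).contDiff.continuous.aestronglyMeasurable) hlim
  have hGm : AEStronglyMeasurable
      (fun x => -(cutPow 1 R (α + 2) (‖x - x₀‖ ^ 2)) • (x - x₀)) (volume.restrict Ω) := by
    have h1 : Measurable fun x : EuclideanSpace ℝ (Fin n) => ‖x - x₀‖ ^ 2 := by fun_prop
    exact (((measurable_cutPow 1 R (α + 2)).comp h1).neg.smul
      (measurable_id.sub_const x₀)).aestronglyMeasurable
  have hub : ∀ e, 0 ≤ e → ∀ x, x ≠ x₀ → ‖cutPrimitive R α (‖x - x₀‖ ^ 2 + e)‖ ≤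
      1 / α * ‖x - x₀‖ ^ (-α) := by
    intro e he x hx
    have h0 : 0 < ‖x - x₀‖ := norm_pos_iff.2 (sub_ne_zero.2 hx)
    rw [Real.norm_of_nonneg (cutPrimitive_nonneg α (by positivity))]
    refine (cutPrimitive_le hR hα (by positivity)).trans ?_
    gcongr
    exact norm_sub_sq_add_rpow_le hx hα.le he
  have hGb : ∀ e, 0 ≤ e → ∀ x, x ≠ x₀ →
      ‖-(cutPow 1 R (α + 2) (‖x - x₀‖ ^ 2 + e)) • (x - x₀)‖ ≤ ‖x - x₀‖ ^ (-(α + 1)) := by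
    intro e he x hx
    rw [norm_smul, norm_neg, Real.norm_of_nonneg (cutPow_nonneg _ _ _ (by positivity))]
    refine (cutPow_mul_norm_le hx 1 R (by linarith) he).trans_eq ?_
    congr 1; ring
  have hLu := memLp_norm_sub_rpow hn hΩ x₀ (q := p) (ν := α) hp0 (by nlinarith)
  have hLG := memLp_norm_sub_rpow hn hΩ x₀ hp0 hαp
  have hu : MemLp (fun x => cutPrimitive R α (‖x - x₀‖ ^ 2)) (ENNReal.ofReal p)
      (volume.restrict Ω) := by
    refine (hLu.const_mul (1 / α)).mono' hum ?_
    filter_upwards [hae] with x hx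
    simpa using hub 0 le_rfl x hx
  have hG : MemLp (fun x => -(cutPow 1 R (α + 2) (‖x - x₀‖ ^ 2)) • (x - x₀)) (ENNReal.ofReal p)
      (volume.restrict Ω) := by
    refine hLG.mono' hGm ?_
    filter_upwards [hae] with x hx
    simpa using hGb 0 le_rfl x hx
  refine IsW1pZeroWithGrad.of_approx hp hu hG hφ ?_ ?_
  · refine tendsto_eLpNorm_zero_of_dominated (by simpa using hp0) (by simp)
      (fun k => hum.sub (hφ k).contDiff.continuous.aestronglyMeasurable)
      ((hLu.const_mul (1 / α)).const_mul 2) (fun k => ?_) ?_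
    · filter_upwards [hae] with x hx
      refine (norm_sub_le _ _).trans ?_
      have h1 := hub 0 le_rfl x hx
      have h2 := hub (1 / ((k : ℝ) + 1)) (by positivity) x hx
      rw [add_zero] at h1
      linarith
    · filter_upwards [hlim] with x hx
      have h1 := hx.const_sub (cutPrimitive R α (‖x - x₀‖ ^ 2))
      rwa [sub_self] at h1
  · refine tendsto_eLpNorm_zero_of_dominated (by simpa using hp0) (by simp)
      (fun k => hGm.sub (hφ k).continuous_gradient.aestronglyMeasurable)
      (hLG.const_mul 2) (fun k => ?_) ?_
    · filter_upwards [hae] with x hx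
      rw [hgrad]
      refine (norm_sub_le _ _).trans ?_
      have h1 := hGb 0 le_rfl x hx
      have h2 := hGb (1 / ((k : ℝ) + 1)) (by positivity) x hx
      rw [add_zero] at h1
      linarith
    · filter_upwards [hae] with x hx
      simp_rw [hgrad]
      have h1 := (tendsto_comp_norm_sub_sq_add hx
        (contDiffOn_cutPow 1 R (α + 2)).continuousOn).neg.smul_const (x - x₀)
      have h2 := h1.const_sub (-(cutPow 1 R (α + 2) (‖x - x₀‖ ^ 2)) • (x - x₀))
      rwa [sub_self] at h2

/-- The divergence theorem for the radial field `cutPow(|x - x₀|²) (x - x₀)`, whose singularity is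
of lower order than `n - 1`, so that the singular point does not contribute. -/
theorem integral_cutPow_mul_inner_gradient {n : ℕ} (hn : 0 < n) {c R μ : ℝ} (hc : 0 < c)
    (hμ : 0 ≤ μ) (hμn : μ < n) {Ω : Set (EuclideanSpace ℝ (Fin n))}
    (hΩ : Bornology.IsBounded Ω) (x₀ : EuclideanSpace ℝ (Fin n))
    {φ : EuclideanSpace ℝ (Fin n) → ℝ} (hφ : IsTestFunction Ω φ) :
    ∫ x in Ω, cutPow c R μ (‖x - x₀‖ ^ 2) * inner ℝ (x - x₀) (gradient φ x) =
      - ∫ x in Ω, (n * cutPow c R μ (‖x - x₀‖ ^ 2) +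
        2 * deriv (cutPow c R μ) (‖x - x₀‖ ^ 2) * ‖x - x₀‖ ^ 2) * φ x := by
  have : Nontrivial (EuclideanSpace ℝ (Fin n)) :=
    Module.nontrivial_of_finrank_pos (R := ℝ) (by simpa using hn)
  have hae : ∀ᵐ x ∂(volume.restrict Ω), x ≠ x₀ := ae_restrict_of_ae (Measure.ae_ne volume x₀)
  obtain ⟨A, hA0, hA⟩ := exists_abs_deriv_cutPow_le hc R μ
  have hb := contDiffOn_cutPow c R μ
  have hb' := continuousOn_deriv_cutPow c R μ
  obtain ⟨B, hB⟩ := hφ.hasCompactSupport.exists_bound_of_continuous hφ.contDiff.continuous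
  obtain ⟨B', hB'⟩ := (hφ.hasCompactSupport.fderiv (𝕜 := ℝ)).exists_bound_of_continuous
    (hφ.contDiff.continuous_fderiv (by simp))
  have hL : ∀ ν : ℝ, ν < n → Integrable (fun x => ‖x - x₀‖ ^ (-ν)) (volume.restrict Ω) := by
    intro ν hν
    rw [← memLp_one_iff_integrable]
    simpa using memLp_norm_sub_rpow hn hΩ x₀ (q := 1) (ν := ν) one_pos (by simpa using hν)
  have hsq : Continuous fun x : EuclideanSpace ℝ (Fin n) => ‖x - x₀‖ ^ 2 := by fun_prop
  have hcont : ∀ (g : ℝ → ℝ) (k : ℕ), ContinuousOn g (Set.Ioi 0) →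
      Continuous fun x : EuclideanSpace ℝ (Fin n) => g (‖x - x₀‖ ^ 2 + 1 / ((k : ℝ) + 1)) :=
    fun g k hg => hg.comp_continuous (hsq.add continuous_const) fun x => by
      simp only [Set.mem_Ioi]; positivity
  have l1 : Tendsto (fun k : ℕ => ∫ x in Ω, cutPow c R μ (‖x - x₀‖ ^ 2 + 1 / ((k : ℝ) + 1)) *
      inner ℝ (x - x₀) (gradient φ x)) atTop (𝓝 (∫ x in Ω, cutPow c R μ (‖x - x₀‖ ^ 2) *
      inner ℝ (x - x₀) (gradient φ x))) := by
    refine tendsto_integral_of_dominated_convergence (fun x => ‖x - x₀‖ ^ (-(μ - 1)) * B')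
      (fun k => ((hcont _ k hb.continuousOn).mul ((continuous_id.sub continuous_const).inner
        hφ.continuous_gradient)).aestronglyMeasurable)
      ((hL _ (by linarith)).mul_const B') (fun k => ?_) ?_
    · filter_upwards [hae] with x hx
      rw [norm_mul, Real.norm_of_nonneg (cutPow_nonneg _ _ _ (by positivity))]
      calc _ ≤ cutPow c R μ (‖x - x₀‖ ^ 2 + 1 / ((k : ℝ) + 1)) *
            (‖x - x₀‖ * ‖gradient φ x‖) := by
            have := cutPow_nonneg c R μ (by positivity : 0 ≤ ‖x - x₀‖ ^ 2 + 1 / ((k : ℝ) + 1))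
            gcongr
            exact norm_inner_le_norm _ _
        _ ≤ _ := by
            rw [← mul_assoc, norm_gradient]
            gcongr
            · exact cutPow_mul_norm_le hx c R hμ (by positivity)
            · exact hB' x
    · filter_upwards [hae] with x hx
      exact (tendsto_comp_norm_sub_sq_add hx hb.continuousOn).mul_const _
  have l2 : Tendsto (fun k : ℕ => ∫ x in Ω, (n * cutPow c R μ (‖x - x₀‖ ^ 2 + 1 / ((k : ℝ) + 1)) +
        2 * deriv (cutPow c R μ) (‖x - x₀‖ ^ 2 + 1 / ((k : ℝ) + 1)) * ‖x - x₀‖ ^ 2) * φ x) atTop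
      (𝓝 (∫ x in Ω, (n * cutPow c R μ (‖x - x₀‖ ^ 2) +
        2 * deriv (cutPow c R μ) (‖x - x₀‖ ^ 2) * ‖x - x₀‖ ^ 2) * φ x)) := by
    refine tendsto_integral_of_dominated_convergence
      (fun x => (n + 2 * A) * ‖x - x₀‖ ^ (-μ) * B)
      (fun k => ((((continuous_const.mul (hcont _ k hb.continuousOn)).add
        ((continuous_const.mul (hcont _ k hb')).mul hsq)).mul
        hφ.contDiff.continuous)).aestronglyMeasurable)
      (((hL _ hμn).const_mul _).mul_const B) (fun k => ?_) ?_
    · filter_upwards [hae] with x hx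
      rw [norm_mul]
      gcongr
      · exact abs_radial_divergence_le hx hμ (by positivity) hA0 hA
      · exact hB x
    · filter_upwards [hae] with x hx
      exact (((tendsto_comp_norm_sub_sq_add hx hb.continuousOn).const_mul _).add
        (((tendsto_comp_norm_sub_sq_add hx hb').const_mul 2).mul_const _)).mul_const _
  refine tendsto_nhds_unique l1 (l2.neg.congr fun k => ?_)
  exact (integral_radial_mul_inner_gradient x₀ hφ hb (by positivity)).symm

/-- The flux `|G|^{p-2} G` of `G = -κ(|x|²) x`, with `κ` of order `|x|^{-(α+2)}`. -/
theorem norm_rpow_mul_inner_cutPow {n : ℕ} {p : ℝ} (hp : 1 < p) (R α : ℝ)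
    (y v : EuclideanSpace ℝ (Fin n)) :
    ‖-(cutPow 1 R (α + 2) (‖y‖ ^ 2)) • y‖ ^ (p - 2) *
        inner ℝ (-(cutPow 1 R (α + 2) (‖y‖ ^ 2)) • y) v =
      -(cutPow (p - 1) R ((α + 1) * (p - 1) + 1) (‖y‖ ^ 2) * inner ℝ y v) := by
  have hp1 : 0 < p - 1 := by linarith
  by_cases hy : y = 0
  · simp [hy]
  have h0 : 0 < ‖y‖ := norm_pos_iff.2 hy
  have hκ := cutPow_nonneg 1 R (α + 2) (sq_nonneg ‖y‖)
  rw [real_inner_smul_left, norm_smul, norm_neg, Real.norm_of_nonneg hκ]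
  set κ := cutPow 1 R (α + 2) (‖y‖ ^ 2) with hκd
  have h1 : (κ * ‖y‖) ^ (p - 2) * κ = κ ^ (p - 1) * ‖y‖ ^ (p - 2) := by
    rw [Real.mul_rpow hκ h0.le]
    rcases hκ.eq_or_lt with h | h
    · rw [← h, Real.zero_rpow hp1.ne']; ring
    · have : κ ^ (p - 1) = κ ^ (p - 2) * κ := by
        rw [← Real.rpow_add_one h.ne']; congr 1; ring
      rw [this]; ring
  have h2 : κ ^ (p - 1) * ‖y‖ ^ (p - 2) =
      cutPow (p - 1) R ((α + 1) * (p - 1) + 1) (‖y‖ ^ 2) := by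
    rw [hκd, cutPow, cutPow, sq_rpow_neg_div_two h0.le, sq_rpow_neg_div_two h0.le,
      Real.mul_rpow (expNegInvGlue.nonneg _) (by positivity), expNegInvGlue_rpow hp1, div_one,
      mul_assoc, ← Real.rpow_mul h0.le, ← Real.rpow_add h0]
    congr 2; ring
  rw [← h2, ← h1]; ring

/-- Sharpness of the exponent: a weak solution with a compactly supported radial singularity
of order `|x - x₀|^{-n/r}`. -/
theorem exists_isWeakSolution_not_memLp {n : ℕ} {p q r : ℝ} (hp : 1 < p) (hpn : p < n)
    (hq1 : 1 < q) (hq : q < n / p) (hqs : n * p / (n * p - n + p) ≤ q)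
    (hr : (p - 1) * q * n / (n - p * q) < r) {Ω : Set (EuclideanSpace ℝ (Fin n))}
    (hΩ : IsBoundedDomain Ω) :
    ∃ f u : EuclideanSpace ℝ (Fin n) → ℝ,
      MemLp f (ENNReal.ofReal q) (volume.restrict Ω) ∧ IsWeakSolution p Ω f u ∧
      ¬ MemLp u (ENNReal.ofReal r) (volume.restrict Ω) := by
  have hp0 : 0 < p := by linarith
  have hp1 : 0 < p - 1 := by linarith
  have hn0 : (0 : ℝ) < n := hp0.trans hpn
  have hn : 0 < n := by exact_mod_cast hn0
  have hq0 : 0 < q := by linarith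
  have hpq : 0 < (n : ℝ) - p * q := by rw [lt_div_iff₀ hp0] at hq; linarith
  have hr0 : 0 < r := lt_trans (by positivity) hr
  have hd : 0 < (n : ℝ) * p - n + p := by nlinarith
  obtain ⟨x₀, hx₀⟩ := hΩ.isConnected.nonempty
  obtain ⟨R, hR, hsub⟩ := Metric.nhds_basis_closedBall.mem_iff.1 (hΩ.isOpen.mem_nhds hx₀)
  have : Nontrivial (EuclideanSpace ℝ (Fin n)) :=
    Module.nontrivial_of_finrank_pos (R := ℝ) (by simpa using hn)
  set α : ℝ := n / r with hα
  have hα0 : 0 < α := by positivity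
  -- `r` above the critical exponent: the datum, of order `(α + 1) (p - 1) + 1`, is in `L^q`
  have hαq : α * ((p - 1) * q) < n - p * q := by
    rw [div_lt_iff₀ hpq] at hr
    rw [hα, div_mul_eq_mul_div, div_lt_iff₀ hr0]
    linarith
  set μ : ℝ := (α + 1) * (p - 1) + 1 with hμ
  have hμ0 : 0 ≤ μ := by positivity
  have hμq : μ * q < n := by
    have : μ * q = α * ((p - 1) * q) + p * q := by rw [hμ]; ring
    linarith
  have hμn : μ < n := by nlinarith
  -- `q` at least the dual Sobolev exponent: the gradient, of order `α + 1`, is in `L^p`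
  have hαp : (α + 1) * p < n := by
    rw [div_le_iff₀ hd] at hqs
    have h1 : p * (n - p * q) ≤ (n - p) * ((p - 1) * q) := by nlinarith
    have h2 : 0 < (p - 1) * q := by positivity
    have h3 : (α * p) * ((p - 1) * q) < (n - p) * ((p - 1) * q) := by nlinarith
    have := lt_of_mul_lt_mul_right h3 h2.le
    linarith
  refine ⟨fun x => n * cutPow (p - 1) R μ (‖x - x₀‖ ^ 2) +
      2 * deriv (cutPow (p - 1) R μ) (‖x - x₀‖ ^ 2) * ‖x - x₀‖ ^ 2,
    fun x => cutPrimitive R α (‖x - x₀‖ ^ 2), ?_, ⟨_, isW1pZeroWithGrad_cutPrimitive hn hp hα0 hαp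
      hR hΩ.isBounded hsub, fun φ hφ => ?_⟩, ?_⟩
  · obtain ⟨A, hA0, hA⟩ := exists_abs_deriv_cutPow_le hp1 R μ
    refine ((memLp_norm_sub_rpow hn hΩ.isBounded x₀ hq0 hμq).const_mul (n + 2 * A)).mono' ?_ ?_
    · have h1 : Measurable fun x : EuclideanSpace ℝ (Fin n) => ‖x - x₀‖ ^ 2 := by fun_prop
      exact ((((measurable_cutPow _ _ _).comp h1).const_mul _).add
        ((((measurable_deriv _).comp h1).const_mul 2).mul h1)).aestronglyMeasurable
    · filter_upwards [ae_restrict_of_ae (Measure.ae_ne volume x₀)] with x hx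
      simpa using abs_radial_divergence_le hx hμ0 le_rfl hA0 hA
  · simp_rw [norm_rpow_mul_inner_cutPow hp]
    rw [integral_neg, integral_cutPow_mul_inner_gradient hn hp1 hμ0 hμn hΩ.isBounded x₀ hφ,
      neg_neg]
  · obtain ⟨c, hc, hcu⟩ := exists_le_cutPrimitive hR hα0
    refine not_memLp_of_le_norm_sub_rpow hn hr0 (ν := α) (by rw [hα]; field_simp; rfl)
      (half_pos hR) hc ((Metric.ball_subset_closedBall.trans
        (Metric.closedBall_subset_closedBall (by linarith))).trans hsub) fun x hx hx0 => ?_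
    have h0 : 0 < ‖x - x₀‖ := norm_pos_iff.2 (sub_ne_zero.2 hx0)
    rw [Metric.mem_ball, dist_eq_norm] at hx
    have h1 := hcu (‖x - x₀‖ ^ 2) (by positivity) (by
      have : ‖x - x₀‖ ^ 2 ≤ (R / 2) ^ 2 := by gcongr
      linarith)
    rwa [sq_rpow_neg_div_two h0.le] at h1

theorem theorem1 (n : ℕ) (p : ℝ) (hp : 1 < p) (hpn : p < n) :
    -- the estimate below the critical exponent
    (∀ q : ℝ, 1 < q → q < n / p →
      ∀ r : ℝ, 0 < r → r < (p - 1) * q * n / (n - p * q) → LebesgueEstimate n p q r) ∧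
    -- sharpness of the exponent, on every bounded domain (in particular on the unit ball)
    (∀ q : ℝ, 1 < q → q < n / p → n * p / (n * p - n + p) ≤ q →
      ∀ r : ℝ, (p - 1) * q * n / (n - p * q) < r →
      ∀ Ω : Set (EuclideanSpace ℝ (Fin n)), IsBoundedDomain Ω →
        ∃ f u : EuclideanSpace ℝ (Fin n) → ℝ,
          MemLp f (ENNReal.ofReal q) (volume.restrict Ω) ∧ IsWeakSolution p Ω f u ∧
          ¬ MemLp u (ENNReal.ofReal r) (volume.restrict Ω)) ∧
    -- the edge case q = n / p
    (∀ r : ℝ, 0 < r → LebesgueEstimate n p (n / p) r) := by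
  exact ⟨fun q hq1 hq r hr hrs => lebesgueEstimate_of_le hp hpn hq1 hq hr hrs.le,
    fun q hq1 hq hqs r hr Ω hΩ => exists_isWeakSolution_not_memLp hp hpn hq1 hq hqs hr hΩ,
    fun r hr => lebesgueEstimate_edge hp hpn hr⟩
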